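/- Let $\mathcal H$ be a finite-dimensional complex Hilbert space and let $A_1,A_2,C$ be positive semi-definite operators on $\mathcal H$. Inequalities between operators are in the L\"owner (positive semi-definite) order, $\mathbb N=\{1,2,\dots\}$, $A^{\otimes n}$ denotes the $n$-fold tensor power of $A$ on $\mathcal H^{\otimes n}$, $\log 0:=-\infty$ and $0^0:=1$. For positive semi-definite $A,B$ and $t\in[0,1]$ the $t$-weighted Kubo--Ando geometric mean is $$B\#_tA:=\lim_{\varepsilon\searrow0}(B+\varepsilon I)^{1/2}\Big((B+\varepsilon I)^{-1/2}(A+\varepsilon I)(B+\varepsilon I)^{-1/2}\Big)^t(B+\varepsilon I)^{1/2}$$ (this limit exists). Then the following are equivalent: (i) For every $n\in\mathbb N$ and every positive semi-definite operator $X$ on $\mathcal H^{\otimes n}$, $$\operatorname{Tr}C^{\otimes n}X\le\max\{\operatorname{Tr}A_1^{\otimes n}X,\ \operatorname{Tr}A_2^{\otimes n}X\}.$$ (ii) There exists $p\in[0,1]$ such that $C^{\otimes n}\le pA_1^{\otimes n}+(1-p)A_2^{\otimes n}$ for every $n\in\mathbb N$. (iii) There exist $p_n,q_n\in[0,+\infty)$,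 $n\in\mathbb N$, such that $C^{\otimes n}\le p_nA_1^{\otimes n}+q_nA_2^{\otimes n}$ for every $n\in\mathbb N$, and $$\lim_{n\to+\infty}\frac1n\log(p_n+q_n)=0.$$ (iv) There exists $t\in[0,1]$ such that for every $n\in\mathbb N$ and every positive semi-definite operator $X$ on $\mathcal H^{\otimes n}$, $$\operatorname{Tr}C^{\otimes n}X\le(\operatorname{Tr}A_1^{\otimes n}X)^{t}\,(\operatorname{Tr}A_2^{\otimes n}X)^{1-t}.$$ (v) There exists $t\in[0,1]$ such that $C\le A_2\#_tA_1$. -/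

import Mathlib

open Set Filter Topology
open scoped TensorProduct

noncomputable section

namespace KuboAndoPowers

variable (H : Type*) [NormedAddCommGroup H] [InnerProductSpace ℂ H]

/-- The `n`-fold tensor power of the Hilbert space `H`. It is a copy of Mathlib's
`⨂[ℂ] _ : Fin n, H`, kept apart from it so that it can carry the Hilbert space
structure (the instances that Mathlib puts on `⨂` come with another norm). -/
def HilbertPower (n : ℕ) : Type _ := ⨂[ℂ] _ : Fin n, H

instance (n : ℕ) : AddCommGroup (HilbertPower H n) :=
  inferInstanceAs (AddCommGroup (⨂[ℂ] _ : Fin n, H))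

instance (n : ℕ) : Module ℂ (HilbertPower H n) :=
  inferInstanceAs (Module ℂ (⨂[ℂ] _ : Fin n, H))

variable {H} in
/-- The elementary tensor `x 0 ⊗ ⋯ ⊗ x (n - 1)`. -/
def pureTensor {n : ℕ} (x : Fin n → H) : HilbertPower H n :=
  PiTensorProduct.tprod ℂ x

variable {H} in
/-- The tensor power `A ⊗ ⋯ ⊗ A` (`n` factors) of an operator on `H`. -/
def opPower (A : H →L[ℂ] H) (n : ℕ) : HilbertPower H n →ₗ[ℂ] HilbertPower H n :=
  PiTensorProduct.map (fun _ : Fin n => (A : H →ₗ[ℂ] H))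

variable {H} in
theorem opPower_pureTensor (A : H →L[ℂ] H) (n : ℕ) (x : Fin n → H) :
    opPower A n (pureTensor x) = pureTensor fun i => A (x i) :=
  PiTensorProduct.map_tprod _ _

variable [FiniteDimensional ℂ H]

/-- The basis of elementary tensors `e_{p 0} ⊗ ⋯ ⊗ e_{p (n - 1)}` built from an orthonormal basis
of `H`. -/
def powerBasis (n : ℕ) :
    Module.Basis (Fin n → Fin (Module.finrank ℂ H)) ℂ (HilbertPower H n) :=
  Basis.piTensorProduct (R := ℂ) (M := fun _ : Fin n => H)
    (fun _ : Fin n => (stdOrthonormalBasis ℂ H).toBasis)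

/-- Coordinates with respect to `powerBasis`. -/
def powerCoords (n : ℕ) :
    HilbertPower H n ≃ₗ[ℂ] EuclideanSpace ℂ (Fin n → Fin (Module.finrank ℂ H)) :=
  (powerBasis H n).equivFun ≪≫ₗ (WithLp.linearEquiv 2 ℂ _).symm

/-- The inner product for which `powerBasis` is orthonormal. By `inner_pureTensor` below it is the
usual one of the tensor power, whatever the orthonormal basis of `H`. -/
@[reducible]
def powerCore (n : ℕ) : InnerProductSpace.Core ℂ (HilbertPower H n) where
  inner x y := inner ℂ (powerCoords H n x) (powerCoords H n y)
  conj_inner_symm x y := inner_conj_symm _ _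
  re_inner_nonneg x := inner_self_nonneg
  add_left x y z := by simp only [map_add, inner_add_left]
  smul_left x y r := by simp only [map_smul, inner_smul_left]
  definite x h := by
    have h0 : powerCoords H n x = 0 := inner_self_eq_zero.mp h
    exact (LinearEquiv.map_eq_zero_iff _).mp h0

instance (n : ℕ) : NormedAddCommGroup (HilbertPower H n) :=
  (powerCore H n).toNormedAddCommGroup

instance (n : ℕ) : InnerProductSpace ℂ (HilbertPower H n) :=
  InnerProductSpace.ofCore (powerCore H n).toCore

instance (n : ℕ) : FiniteDimensional ℂ (HilbertPower H n) :=
  (powerBasis H n).finiteDimensional_of_finite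

variable {H}

theorem inner_def {n : ℕ} (x y : HilbertPower H n) :
    inner ℂ x y = inner ℂ (powerCoords H n x) (powerCoords H n y) := rfl

/-- The inner product of the tensor power is multiplicative on elementary tensors. -/
theorem inner_pureTensor {n : ℕ} (x y : Fin n → H) :
    inner ℂ (pureTensor x) (pureTensor y) = ∏ i, inner ℂ (x i) (y i) := by
  have hc : ∀ (z : Fin n → H) (p : Fin n → Fin (Module.finrank ℂ H)),
      powerCoords H n (pureTensor z) p = ∏ i, inner ℂ (stdOrthonormalBasis ℂ H (p i)) (z i) := by
    intro z p
    have h := Basis.piTensorProduct_repr_tprod_apply (R := ℂ) (M := fun _ : Fin n => H)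
      (fun _ : Fin n => (stdOrthonormalBasis ℂ H).toBasis) z p
    simp only [OrthonormalBasis.coe_toBasis_repr_apply, OrthonormalBasis.repr_apply_apply] at h
    exact h
  rw [inner_def, PiLp.inner_apply]
  simp only [hc, RCLike.inner_apply, map_prod, inner_conj_symm]
  simp only [← Finset.prod_mul_distrib]
  rw [← Fintype.prod_sum (fun i j => inner ℂ (stdOrthonormalBasis ℂ H j) (y i) *
    inner ℂ (x i) (stdOrthonormalBasis ℂ H j))]
  refine Finset.prod_congr rfl fun i _ => ?_
  rw [← (stdOrthonormalBasis ℂ H).sum_inner_mul_inner (x i) (y i)]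
  exact Finset.sum_congr rfl fun j _ => mul_comm _ _

/-- The number `Tr (A^{⊗n} X)`. For positive semi-definite `A` and `X` the trace is a non-negative
real, so that taking the real part only changes the type. -/
def powTr (A : H →L[ℂ] H) (n : ℕ) (X : HilbertPower H n →ₗ[ℂ] HilbertPower H n) : ℝ :=
  (LinearMap.trace ℂ (HilbertPower H n) (opPower A n ∘ₗ X)).re

/-- The weighted geometric mean `B^{1/2} (B^{-1/2} A B^{-1/2})^t B^{1/2}` of positive definite
operators; the powers are those of the continuous functional calculus. -/
def geomMean [CompleteSpace H] (t : ℝ) (B A : H →L[ℂ] H) : H →L[ℂ] H :=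
  B ^ (1 / 2 : ℝ) * (B ^ (-1 / 2 : ℝ) * A * B ^ (-1 / 2 : ℝ)) ^ t * B ^ (1 / 2 : ℝ)

/-- `G` is the `t`-weighted Kubo-Ando geometric mean `B #_t A` of the positive semi-definite
operators `B` and `A`: the limit of the means of `B + ε I` and `A + ε I` as `ε ↘ 0`. -/
def IsKuboAndoMean [CompleteSpace H] (t : ℝ) (B A G : H →L[ℂ] H) : Prop :=
  Tendsto (fun ε : ℝ => geomMean t (B + (ε : ℂ) • 1) (A + (ε : ℂ) • 1)) (𝓝[>] 0) (𝓝 G)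

end KuboAndoPowers

end

open KuboAndoPowers

/-! Two positive operators can be diagonalised together by congruence: there is a basis `v`, in
general not orthogonal, with `A₁ = ∑ αᵢ |vᵢ⟩⟨vᵢ|` and `A₂ = ∑ βᵢ |vᵢ⟩⟨vᵢ|`
(`exists_simultaneous_diagOp`). The Kubo-Ando mean is then `∑ αᵢ^t βᵢ^(1-t) |vᵢ⟩⟨vᵢ|`
(`isKuboAndoMean_diagOp`), and tensor powers are diagonal in the product basis, so (v) reduces to
scalar inequalities there: Hölder gives (iv) and weighted AM-GM gives (ii). Clearly (iv) implies (i)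
and (ii) implies (iii); for fixed `n`, a separation argument in the plane turns (i) into an operator
inequality with weights `p n` and `1 - p n`, hence (iii).

The substance is (iii) → (v), in `exists_tensorForm_le_rpow`. Take a vector of the tensor power
supported on words whose weights `∏ α` and `∏ β` have constant values `a` and `b`, and let `c` be
the value of `C^{⊗n}` on it, normalised. Then `c ≤ (p n + q n) max(a, b)`. Such triples `(a, b, c)`
multiply under tensor products, so passing to powers removes the subexponential factor. In
logarithms the triples form an additive semigroup, and separation yields one `t` with `c ≤ a^t
b^(1-t)` for all of them. A power `x^{⊗n}` splits into polynomially many vectors of this kind, one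
for each type of word; an `n`-th root then gives `C ≤ A₂ #_t A₁`. -/

open InnerProductSpace

/-! ### Operators diagonal in a family of vectors -/

section DiagOp

variable {H : Type*} [NormedAddCommGroup H] [InnerProductSpace ℂ H] {ι : Type*} [Fintype ι]

/-- The operator `∑ i, α i |v i⟩⟨v i|`. -/
noncomputable def diagOp (v : ι → H) (α : ι → ℝ) : H →L[ℂ] H :=
  ∑ i, (α i : ℂ) • rankOne ℂ (v i) (v i)

theorem diagOp_apply (v : ι → H) (α : ι → ℝ) (x : H) :
    diagOp v α x = ∑ i, (α i : ℂ) • inner ℂ (v i) x • v i := by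
  simp [diagOp, rankOne_apply]

theorem inner_diagOp (v : ι → H) (α : ι → ℝ) (x y : H) :
    inner ℂ x (diagOp v α y) = ∑ i, (α i : ℂ) * (inner ℂ x (v i) * inner ℂ (v i) y) := by
  rw [diagOp_apply, inner_sum]
  refine Finset.sum_congr rfl fun i _ => ?_
  rw [inner_smul_right, inner_smul_right]
  ring

theorem inner_diagOp_self (v : ι → H) (α : ι → ℝ) (x : H) :
    inner ℂ x (diagOp v α x) = ((∑ i, α i * ‖inner ℂ (v i) x‖ ^ 2 : ℝ) : ℂ) := by
  rw [inner_diagOp]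
  push_cast
  refine Finset.sum_congr rfl fun i _ => ?_
  rw [← inner_conj_symm x (v i), Complex.conj_mul']

theorem diagOp_add (v : ι → H) (α β : ι → ℝ) :
    diagOp v (fun i => α i + β i) = diagOp v α + diagOp v β := by
  simp [diagOp, add_smul, Finset.sum_add_distrib]

theorem diagOp_smul (v : ι → H) (c : ℝ) (α : ι → ℝ) :
    diagOp v (fun i => c * α i) = (c : ℂ) • diagOp v α := by
  simp [diagOp, mul_smul, Finset.smul_sum]

theorem diagOp_sub (v : ι → H) (α β : ι → ℝ) :
    diagOp v (fun i => α i - β i) = diagOp v α - diagOp v β := by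
  simp [diagOp, sub_smul, Finset.sum_sub_distrib]

theorem diagOp_isPositive (v : ι → H) {α : ι → ℝ} (h : ∀ i, 0 ≤ α i) :
    (diagOp v α).IsPositive := by
  refine ContinuousLinearMap.isPositive_sum _ fun i _ => ?_
  exact (isPositive_rankOne_self (v i)).smul_of_nonneg (by exact_mod_cast h i)

theorem diagOp_mono (v : ι → H) {α β : ι → ℝ} (h : ∀ i, α i ≤ β i) :
    diagOp v α ≤ diagOp v β := by
  rw [ContinuousLinearMap.le_def, ← diagOp_sub]
  exact diagOp_isPositive v fun i => sub_nonneg.2 (h i)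

variable [CompleteSpace H]

theorem diagOp_conj (T : H →L[ℂ] H) (hT : IsSelfAdjoint T) (v : ι → H) (α : ι → ℝ) :
    T * diagOp v α * T = diagOp (fun i => T (v i)) α := by
  ext x
  have h (i : ι) : inner ℂ (v i) (T x) = inner ℂ (T (v i)) x :=
    (hT.isSymmetric (v i) x).symm
  simp [diagOp_apply, h]

end DiagOp

/-! ### Dual basis and positivity of diagonal operators -/

section Basis

variable {H : Type*} [NormedAddCommGroup H] [InnerProductSpace ℂ H] [FiniteDimensional ℂ H]
  {ι : Type*} [Fintype ι]

/-- Since `v` need not be orthogonal, coefficients are extracted with the biorthogonal basis `w`: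
`diagOp v α` sends `w i` to `α i • v i`. -/
theorem exists_inner_dual (v : Module.Basis ι ℂ H) :
    ∃ w : ι → H, (∀ i x, inner ℂ (w i) x = v.repr x i) ∧
      (∀ i, inner ℂ (v i) (w i) = 1) ∧ (∀ i j, i ≠ j → inner ℂ (v i) (w j) = 0) ∧
      ∀ x, x = ∑ i, inner ℂ (v i) x • w i := by
  classical
  have : CompleteSpace H := FiniteDimensional.complete ℂ H
  let w : ι → H := fun i => (toDual ℂ H).symm (LinearMap.toContinuousLinearMap (v.coord i))
  have hw : ∀ i x, inner ℂ (w i) x = v.repr x i := fun i x => by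
    simp [w]
  have h1 : ∀ i, inner ℂ (v i) (w i) = 1 := fun i => by
    rw [← inner_conj_symm, hw]; simp
  have h0 : ∀ i j, i ≠ j → inner ℂ (v i) (w j) = 0 := fun i j hij => by
    rw [← inner_conj_symm, hw]; simp [hij]
  refine ⟨w, hw, h1, h0, fun x => InnerProductSpace.ext_inner_left_basis v fun j => ?_⟩
  rw [inner_sum, Finset.sum_eq_single j]
  · rw [inner_smul_right, h1, mul_one]
  · intro i _ hi
    rw [inner_smul_right, h0 _ _ hi.symm, mul_zero]
  · simp

theorem le_of_diagOp_le (v : Module.Basis ι ℂ H) {α β : ι → ℝ}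
    (h : diagOp v α ≤ diagOp v β) (i : ι) : α i ≤ β i := by
  obtain ⟨w, -, h1, h0, -⟩ := exists_inner_dual v
  rw [ContinuousLinearMap.le_def, ← diagOp_sub] at h
  have := h.re_inner_nonneg_right (w i)
  rw [inner_diagOp_self, Finset.sum_eq_single i] at this
  · rw [h1] at this
    simpa using this
  · intro j _ hj
    rw [h0 _ _ hj]; simp
  · simp

variable [CompleteSpace H]

theorem diagOp_isStrictlyPositive (v : Module.Basis ι ℂ H) {α : ι → ℝ} (h : ∀ i, 0 < α i) :
    IsStrictlyPositive (diagOp v α) := by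
  have hp := diagOp_isPositive v (fun i => (h i).le)
  rw [IsStrictlyPositive.iff_of_unital]
  refine ⟨(ContinuousLinearMap.nonneg_iff_isPositive _).2 hp, ?_⟩
  rw [ContinuousLinearMap.isUnit_iff_isUnit_toLinearMap, LinearMap.isUnit_iff_ker_eq_bot,
    LinearMap.ker_eq_bot']
  intro x hx
  have hx' : diagOp v α x = 0 := hx
  have := inner_diagOp_self v α x
  rw [hx', inner_zero_right] at this
  have h2 : ∑ i, α i * ‖inner ℂ (v i) x‖ ^ 2 = 0 := by exact_mod_cast this.symm
  rw [Finset.sum_eq_zero_iff_of_nonneg fun i _ => mul_nonneg (h i).le (sq_nonneg _)] at h2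
  refine InnerProductSpace.ext_inner_left_basis v fun i => ?_
  have := h2 i (Finset.mem_univ i)
  rw [inner_zero_right]
  simpa [(h i).ne'] using this

end Basis

/-! ### Real powers in an orthonormal basis -/

section Rpow

variable {H : Type*} [NormedAddCommGroup H] [InnerProductSpace ℂ H] [FiniteDimensional ℂ H]
  [CompleteSpace H] {ι : Type*} [Fintype ι]

/-- The operators that are diagonal in an orthonormal basis form an algebra. -/
noncomputable def diagHom (u : OrthonormalBasis ι ℂ H) : (ι → ℂ) →⋆ₐ[ℂ] (H →L[ℂ] H) where
  toFun c := ∑ i, c i • rankOne ℂ (u i) (u i)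
  map_one' := by
    simp only [Pi.one_apply, one_smul, u.sum_rankOne_eq_id]
    rfl
  map_zero' := by simp
  map_add' a b := by simp [add_smul, Finset.sum_add_distrib]
  commutes' r := by
    have := u.sum_rankOne_eq_id
    simp only [Pi.algebraMap_apply, Algebra.algebraMap_self, RingHom.id_apply, ← Finset.smul_sum, this]
    rw [Algebra.algebraMap_eq_smul_one]; rfl
  map_mul' a b := by
    classical
    rw [Finset.sum_mul_sum]
    refine Finset.sum_congr rfl fun i _ => ?_
    rw [Finset.sum_eq_single i]
    · rw [smul_mul_smul_comm, ContinuousLinearMap.mul_def, rankOne_comp_rankOne, u.inner_eq_one,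
        one_smul]
      rfl
    · intro j _ hj
      rw [smul_mul_smul_comm, ContinuousLinearMap.mul_def, rankOne_comp_rankOne,
        u.inner_eq_zero hj.symm, zero_smul, smul_zero]
    · simp
  map_star' a := by
    simp [star_sum, ContinuousLinearMap.star_eq_adjoint]

omit [FiniteDimensional ℂ H] in
theorem diagHom_apply (u : OrthonormalBasis ι ℂ H) (α : ι → ℝ) :
    diagHom u (fun i => (α i : ℂ)) = diagOp u α := rfl

-- The spectrum lies among the finitely many `α i`, where `x ^ t` agrees with an interpolation
-- polynomial, and the homomorphism `diagHom u` commutes with polynomials.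
omit [FiniteDimensional ℂ H] in
theorem rpow_diagOp (u : OrthonormalBasis ι ℂ H) {α : ι → ℝ} (h : ∀ i, 0 ≤ α i) (t : ℝ) :
    diagOp u α ^ t = diagOp u (fun i => α i ^ t) := by
  classical
  have hp := (ContinuousLinearMap.nonneg_iff_isPositive _).2 (diagOp_isPositive u h)
  have hsp : ∀ x ∈ spectrum ℝ (diagOp u α), ∃ i, x = α i := by
    intro x hx
    have h1 : x ∈ spectrum ℝ (fun i => (α i : ℂ)) :=
      AlgHom.spectrum_apply_subset ((diagHom u).toAlgHom.restrictScalars ℝ) _ hx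
    by_contra! hne
    refine h1 (Pi.isUnit_iff.2 fun i => ?_)
    rw [isUnit_iff_ne_zero]
    simp only [Pi.sub_apply, Pi.algebraMap_apply, Complex.coe_algebraMap]
    exact_mod_cast sub_ne_zero.2 (hne i)
  let p : Polynomial ℝ := Lagrange.interpolate (Finset.univ.image α) id fun x => x ^ t
  have hpe : ∀ i, p.eval (α i) = α i ^ t := fun i =>
    Lagrange.eval_interpolate_at_node (v := id) (fun x => x ^ t) Function.injective_id.injOn
      (Finset.mem_image_of_mem α (Finset.mem_univ i))
  rw [CFC.rpow_eq_cfc_real hp, cfc_congr (g := p.eval) (fun x hx => by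
    obtain ⟨i, rfl⟩ := hsp x hx
    exact (hpe i).symm), cfc_polynomial p _ hp.isSelfAdjoint, ← diagHom_apply, ← diagHom_apply]
  have := Polynomial.aeval_algHom_apply ((diagHom u).toAlgHom.restrictScalars ℝ)
    (fun i => (α i : ℂ)) p
  refine this.trans (congrArg (diagHom u) ?_)
  ext i
  rw [Polynomial.aeval_pi_apply₂]
  simp only [← hpe]
  exact Polynomial.aeval_algebraMap_apply_eq_algebraMap_eval (A := ℂ) (α i) p

end Rpow

/-! ### Simultaneous diagonalisation and the geometric mean -/

section GeomMean

variable {H : Type*} [NormedAddCommGroup H] [InnerProductSpace ℂ H] {ι : Type*} [Fintype ι]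

theorem diagOp_smul_vec (c : ι → ℝ) (v : ι → H) (α : ι → ℝ) :
    diagOp (fun i => (c i : ℂ) • v i) α = diagOp v (fun i => c i ^ 2 * α i) := by
  ext x
  simp only [diagOp_apply, inner_smul_left, smul_smul, Complex.conj_ofReal]
  refine Finset.sum_congr rfl fun i _ => ?_
  congr 1
  push_cast
  ring

variable [FiniteDimensional ℂ H] [CompleteSpace H]

/-- Put `B = diagOp v β`. The vectors `√βᵢ B^{-1/2} vᵢ` form an orthonormal basis in which `B^{-1/2}
A B^{-1/2}` has the entries `αᵢ / βᵢ`. Its power is taken entrywise, and `B^{1/2}` carries the basis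
back to multiples of `v`. -/
theorem geomMean_diagOp (v : Module.Basis ι ℂ H) {α β : ι → ℝ} (hα : ∀ i, 0 < α i)
    (hβ : ∀ i, 0 < β i) (t : ℝ) :
    geomMean t (diagOp v β) (diagOp v α) = diagOp v (fun i => α i ^ t * β i ^ (1 - t)) := by
  have hB := diagOp_isStrictlyPositive v hβ
  have hBB : diagOp v β ^ (1 / 2 : ℝ) * diagOp v β ^ (1 / 2 : ℝ) = diagOp v β := by
    rw [← CFC.rpow_add hB.isUnit]
    norm_num [CFC.rpow_one _ hB.nonneg]
  have hDR : diagOp v β ^ (-1 / 2 : ℝ) * diagOp v β ^ (1 / 2 : ℝ) = 1 := by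
    rw [neg_div]; exact CFC.rpow_neg_mul_rpow _ hB
  have hRD : diagOp v β ^ (1 / 2 : ℝ) * diagOp v β ^ (-1 / 2 : ℝ) = 1 := by
    rw [neg_div]; exact CFC.rpow_mul_rpow_neg _ hB
  unfold geomMean
  have hDs : IsSelfAdjoint (diagOp v β ^ (-1 / 2 : ℝ)) := CFC.rpow_nonneg.isSelfAdjoint
  have hRs : IsSelfAdjoint (diagOp v β ^ (1 / 2 : ℝ)) := CFC.rpow_nonneg.isSelfAdjoint
  set D := diagOp v β ^ (-1 / 2 : ℝ)
  set R := diagOp v β ^ (1 / 2 : ℝ)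
  have hDDB : D * (D * diagOp v β) = 1 := by
    rw [← hBB, ← mul_assoc D R, hDR, one_mul, hDR]
  have hDBD : D * diagOp v β * D = 1 := by
    rw [← hBB, ← mul_assoc D R, hDR, one_mul, hRD]
  let u : ι → H := fun i => ((√(β i) : ℝ) : ℂ) • D (v i)
  have hu1 : diagOp u (fun _ => 1) = 1 := by
    rw [diagOp_smul_vec, ← hDBD, diagOp_conj _ hDs]
    simp [Real.sq_sqrt (hβ _).le]
  obtain ⟨w, -, hw1, hw0, -⟩ := exists_inner_dual v
  -- The dual basis is `w j = β j • B⁻¹ (v j)`, so orthonormality of `u` is biorthogonality of `v`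
  -- and `w`.
  have hw : ∀ j, w j = (β j : ℂ) • D (D (v j)) := by
    intro j
    have h1 : diagOp v β (w j) = (β j : ℂ) • v j := by
      rw [diagOp_apply, Finset.sum_eq_single j]
      · rw [hw1, one_smul]
      · intro i _ hi
        rw [hw0 _ _ hi, zero_smul, smul_zero]
      · simp
    have h2 : D (D (diagOp v β (w j))) = w j := by
      have := congrArg (fun T : H →L[ℂ] H => T (w j)) hDDB
      simpa using this
    rw [← h2, h1, map_smul, map_smul]
  have hpair : ∀ i j, inner ℂ (u i) (u j) = ((√(β i) / √(β j) : ℝ) : ℂ) * inner ℂ (v i) (w j) := by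
    intro i j
    have h3 : (β j : ℂ) = ((√(β j) : ℝ) : ℂ) * ((√(β j) : ℝ) : ℂ) := by
      rw [← Complex.ofReal_mul, Real.mul_self_sqrt (hβ j).le]
    have h4 : ((√(β j) : ℝ) : ℂ) ≠ 0 := by
      exact_mod_cast (Real.sqrt_pos.2 (hβ j)).ne'
    have h5 : inner ℂ (D (v i)) (D (v j)) = inner ℂ (v i) (D (D (v j))) :=
      hDs.isSymmetric _ _
    rw [hw j]
    simp only [u, inner_smul_left, inner_smul_right, Complex.conj_ofReal, h5]
    rw [h3]
    push_cast
    field_simp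
  have huo : Orthonormal ℂ u := by
    classical
    rw [orthonormal_iff_ite]
    intro i j
    rw [hpair]
    split_ifs with hij
    · subst hij
      rw [hw1, mul_one, div_self (Real.sqrt_pos.2 (hβ i)).ne', Complex.ofReal_one]
    · rw [hw0 _ _ hij, mul_zero]
  have hus : ⊤ ≤ Submodule.span ℂ (Set.range u) := by
    intro x _
    have h6 : x = diagOp u (fun _ => 1) x := by rw [hu1]; rfl
    rw [h6, diagOp_apply]
    exact Submodule.sum_mem _ fun i _ => Submodule.smul_mem _ _ (Submodule.smul_mem _ _
      (Submodule.subset_span ⟨i, rfl⟩))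
  let U : OrthonormalBasis ι ℂ H := OrthonormalBasis.mk huo hus
  have hU : ⇑U = u := OrthonormalBasis.coe_mk huo hus
  have hDAD : D * diagOp v α * D = diagOp U (fun i => α i / β i) := by
    rw [diagOp_conj _ hDs, hU, diagOp_smul_vec]
    congr 1
    ext i
    rw [Real.sq_sqrt (hβ i).le, mul_div_cancel₀ _ (hβ i).ne']
  have hRu : ∀ i, R (u i) = ((√(β i) : ℝ) : ℂ) • v i := by
    intro i
    have := congrArg (fun T : H →L[ℂ] H => T (v i)) hRD
    simp only [u, map_smul]
    congr 1
  rw [hDAD, rpow_diagOp U (fun i => (div_pos (hα i) (hβ i)).le), diagOp_conj _ hRs, hU]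
  simp only [hRu]
  rw [diagOp_smul_vec]
  congr 1
  ext i
  rw [Real.sq_sqrt (hβ i).le, Real.div_rpow (hα i).le (hβ i).le, Real.rpow_sub (hβ i),
    Real.rpow_one]
  ring

omit [CompleteSpace H] in
theorem exists_eq_diagOp_one {T : H →L[ℂ] H} (hT : T.IsPositive) :
    ∃ (m : ℕ) (u : Fin m → H), T = diagOp u (fun _ => 1) := by
  obtain ⟨m, u, h⟩ := ContinuousLinearMap.isPositive_iff_eq_sum_rankOne.1 hT
  exact ⟨m, u, by simp [h, diagOp]⟩

omit [CompleteSpace H] in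
theorem apply_eq_zero_of_re_inner_eq_zero {T : H →L[ℂ] H} (hT : T.IsPositive) {x : H}
    (hx : (inner ℂ x (T x)).re = 0) : T x = 0 := by
  obtain ⟨m, u, rfl⟩ := exists_eq_diagOp_one hT
  rw [inner_diagOp_self, Complex.ofReal_re,
    Finset.sum_eq_zero_iff_of_nonneg fun i _ => mul_nonneg zero_le_one (sq_nonneg _)] at hx
  rw [diagOp_apply]
  refine Finset.sum_eq_zero fun i hi => ?_
  have : inner ℂ (u i) x = 0 := by simpa using hx i hi
  rw [this, zero_smul, smul_zero]

omit [FiniteDimensional ℂ H] [CompleteSpace H] in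
theorem eq_diagOp_of_apply_eq (u : OrthonormalBasis ι ℂ H) {T : H →L[ℂ] H} {α : ι → ℝ}
    (h : ∀ i, T (u i) = (α i : ℂ) • u i) : T = diagOp u α := by
  ext x
  conv_lhs => rw [← u.sum_repr' x]
  rw [map_sum, diagOp_apply]
  refine Finset.sum_congr rfl fun i _ => ?_
  rw [map_smul, h, smul_comm]

/-- Normalise by congruence so that the sum becomes the identity; the two operators then commute.
Adding the projection `Q` onto the kernel of `A + B` makes the sum invertible even when both are
singular. -/
theorem exists_simultaneous_diagOp {A B : H →L[ℂ] H} (hA : A.IsPositive) (hB : B.IsPositive) :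
    ∃ (v : Module.Basis (Fin (Module.finrank ℂ H)) ℂ H) (α β : Fin (Module.finrank ℂ H) → ℝ),
      (∀ i, 0 ≤ α i) ∧ (∀ i, 0 ≤ β i) ∧ A = diagOp v α ∧ B = diagOp v β := by
  have hA0 := (ContinuousLinearMap.nonneg_iff_isPositive _).2 hA
  have hB0 := (ContinuousLinearMap.nonneg_iff_isPositive _).2 hB
  let K : Submodule ℂ H := LinearMap.ker (A + B : H →L[ℂ] H).toLinearMap
  let Q : H →L[ℂ] H := K.starProjection
  have hQ : Q.IsPositive := ContinuousLinearMap.IsPositive.of_isStarProjection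
    isStarProjection_starProjection
  have hQ0 := (ContinuousLinearMap.nonneg_iff_isPositive _).2 hQ
  have hker : ∀ x, (A + B) x = 0 → A x = 0 ∧ B x = 0 := by
    intro x hx
    have h1 := hA.re_inner_nonneg_right x
    have h2 := hB.re_inner_nonneg_right x
    have h3 : (inner ℂ x ((A + B) x)).re = 0 := by rw [hx]; simp
    simp only [_root_.add_apply, inner_add_right, Complex.add_re] at h3
    simp only [RCLike.re_eq_complex_re] at h1 h2
    exact ⟨apply_eq_zero_of_re_inner_eq_zero hA (by linarith), apply_eq_zero_of_re_inner_eq_zero hB (by linarith)⟩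
  have hAQ : A * Q = 0 := by
    ext x
    exact (hker (Q x) (K.starProjection_apply_mem x)).1
  have hBQ : B * Q = 0 := by
    ext x
    exact (hker (Q x) (K.starProjection_apply_mem x)).2
  have hQA : Q * A = 0 := by
    have := congrArg star hAQ
    rwa [star_mul, hA.isSelfAdjoint.star_eq, hQ.isSelfAdjoint.star_eq, star_zero] at this
  have hQB : Q * B = 0 := by
    have := congrArg star hBQ
    rwa [star_mul, hB.isSelfAdjoint.star_eq, hQ.isSelfAdjoint.star_eq, star_zero] at this
  have hS : IsStrictlyPositive (A + B + Q) := by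
    rw [IsStrictlyPositive.iff_of_unital]
    refine ⟨add_nonneg (add_nonneg hA0 hB0) hQ0, ?_⟩
    rw [ContinuousLinearMap.isUnit_iff_isUnit_toLinearMap, LinearMap.isUnit_iff_ker_eq_bot,
      LinearMap.ker_eq_bot']
    intro x hx
    have hx' : (A + B + Q) x = 0 := hx
    have h1 := hA.re_inner_nonneg_right x
    have h2 := hB.re_inner_nonneg_right x
    have h4 := hQ.re_inner_nonneg_right x
    have h3 : (inner ℂ x ((A + B + Q) x)).re = 0 := by rw [hx']; simp
    simp only [_root_.add_apply, inner_add_right, Complex.add_re] at h3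
    simp only [RCLike.re_eq_complex_re] at h1 h2 h4
    have h5 : Q x = 0 := apply_eq_zero_of_re_inner_eq_zero hQ (by linarith)
    have h6 : x ∈ K := by
      change (A + B) x = 0
      simpa [h5] using hx'
    rw [← h5]
    exact (Submodule.starProjection_eq_self_iff.2 h6).symm
  set S := A + B + Q with hSdef
  have hcom : Commute Q S := by
    have h1 : Q * S = Q * Q := by rw [hSdef, mul_add, mul_add, hQA, hQB]; simp
    have h2 : S * Q = Q * Q := by rw [hSdef, add_mul, add_mul, hAQ, hBQ]; simp
    exact h1.trans h2.symm
  have hSS : S ^ (1 / 2 : ℝ) * S ^ (1 / 2 : ℝ) = S := by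
    rw [← CFC.rpow_add hS.isUnit]
    norm_num [CFC.rpow_one _ hS.nonneg]
  have hDR : S ^ (-(1 / 2) : ℝ) * S ^ (1 / 2 : ℝ) = 1 := CFC.rpow_neg_mul_rpow _ hS
  have hRD : S ^ (1 / 2 : ℝ) * S ^ (-(1 / 2) : ℝ) = 1 := CFC.rpow_mul_rpow_neg _ hS
  have hDs : IsSelfAdjoint (S ^ (-(1 / 2) : ℝ)) := CFC.rpow_nonneg.isSelfAdjoint
  have hRs : IsSelfAdjoint (S ^ (1 / 2 : ℝ)) := CFC.rpow_nonneg.isSelfAdjoint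
  have hDSD : S ^ (-(1 / 2) : ℝ) * S * S ^ (-(1 / 2) : ℝ) = 1 := CFC.conjugate_rpow_neg_one_half S hS
  -- `Q` passes through `S^{-1/2}`, so `A Q = B Q = 0` survives the congruence.
  have hcD : Commute Q (S ^ (-(1 / 2) : ℝ)) := by
    rw [CFC.rpow_eq_cfc_real hS.nonneg]
    exact (hcom.symm.cfc_real _).symm
  set D := S ^ (-(1 / 2) : ℝ)
  set R := S ^ (1 / 2 : ℝ)
  have conj_pos : ∀ {T : H →L[ℂ] H}, 0 ≤ T → (D * T * D).IsPositive := fun hT =>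
    (ContinuousLinearMap.nonneg_iff_isPositive _).1 (hDs.conjugate_nonneg hT)
  have conj_zero : ∀ {T : H →L[ℂ] H}, T * Q = 0 → D * T * D * (D * Q * D) = 0 := by
    intro T hT
    calc D * T * D * (D * Q * D) = D * T * (D * (D * Q)) * D := by noncomm_ring
      _ = D * (T * Q) * D * D * D := by rw [← hcD.eq, ← mul_assoc D Q D, ← hcD.eq]; noncomm_ring
      _ = 0 := by rw [hT]; simp
  have conj_zero' : ∀ {T : H →L[ℂ] H}, Q * T = 0 → D * Q * D * (D * T * D) = 0 := by
    intro T hT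
    calc D * Q * D * (D * T * D) = D * ((Q * D) * D) * T * D := by noncomm_ring
      _ = D * D * D * (Q * T) * D := by rw [hcD.eq, mul_assoc D Q D, hcD.eq]; noncomm_ring
      _ = 0 := by rw [hT]; simp
  have conj_inv : ∀ T : H →L[ℂ] H, R * (D * T * D) * R = T := by
    intro T
    calc R * (D * T * D) * R = (R * D) * T * (D * R) := by noncomm_ring
      _ = T := by rw [hRD, hDR, one_mul, mul_one]
  have hA' := conj_pos hA0
  have hB' := conj_pos hB0
  have hQ' := conj_pos hQ0
  have hAQ' := conj_zero hAQ
  have hQA' := conj_zero' hQA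
  have hQB' := conj_zero' hQB
  have hsum : D * A * D + D * B * D + D * Q * D = 1 := by
    rw [← hDSD, hSdef]; noncomm_ring
  have hAR := conj_inv A
  have hBR := conj_inv B
  set A' := D * A * D
  set B' := D * B * D
  set Q' := D * Q * D
  have hQQ : Q' * Q' = Q' := by
    have := congrArg (Q' * ·) hsum
    simpa [mul_add, hQA', hQB'] using this
  -- Since `B' = 1 - A' - Q'`, eigenvectors of both `A'` and `Q'` are wanted. The kernel of `A'` may
  -- mix the range of `Q'` with other vectors; subtracting `Q'` moves that range to the eigenvalue
  -- `-1`, while the rest of the spectrum is nonnegative.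
  have hM : (A' - Q').toLinearMap.IsSymmetric :=
    (hA'.isSelfAdjoint.sub hQ'.isSelfAdjoint).isSymmetric
  let u := hM.eigenvectorBasis rfl
  have key : ∀ i, ∃ a b : ℝ, A' (u i) = (a : ℂ) • u i ∧ B' (u i) = (b : ℂ) • u i := by
    intro i
    have hs : A' (u i) + B' (u i) + Q' (u i) = u i :=
      congrArg (fun T : H →L[ℂ] H => T (u i)) hsum
    have hu : A' (u i) - Q' (u i) = ((hM.eigenvalues rfl i : ℝ) : ℂ) • u i :=
      hM.apply_eigenvectorBasis rfl i
    set μ := hM.eigenvalues rfl i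
    by_cases h0 : Q' (u i) = 0
    · rw [h0, sub_zero] at hu
      refine ⟨μ, 1 - μ, hu, ?_⟩
      rw [h0, add_zero, hu] at hs
      rw [Complex.ofReal_sub, Complex.ofReal_one, sub_smul, one_smul]
      exact eq_sub_of_add_eq' hs
    · have e1 : Q' (A' (u i)) = 0 := congrArg (fun T : H →L[ℂ] H => T (u i)) hQA'
      have e2 : Q' (Q' (u i)) = Q' (u i) := congrArg (fun T : H →L[ℂ] H => T (u i)) hQQ
      have e3 : A' (Q' (u i)) = 0 := congrArg (fun T : H →L[ℂ] H => T (u i)) hAQ'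
      have hμ : (μ : ℂ) = -1 := by
        have := congrArg Q' hu
        rw [map_sub, map_smul, e1, e2, zero_sub, ← neg_one_smul ℂ] at this
        exact (smul_left_injective ℂ h0 this).symm
      rw [hμ, neg_one_smul] at hu
      -- Applying `A'` to the eigenvalue equation gives `A' (A' u) = -A' u`, so `‖A' u‖² = -⟨u, A'
      -- u⟩ ≤ 0`.
      have h1 : A' (u i) = 0 := by
        have := congrArg A' hu
        rw [map_sub, e3, sub_zero, map_neg] at this
        have h2 : inner ℂ (A' (u i)) (A' (u i)) = inner ℂ (u i) (A' (A' (u i))) :=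
          hA'.isSymmetric _ _
        rw [this, inner_neg_right] at h2
        have h3 := hA'.re_inner_nonneg_right (u i)
        have h4 := congrArg Complex.re h2
        rw [inner_self_eq_norm_sq_to_K] at h4
        have h5 : ‖A' (u i)‖ ^ 2 = -(inner ℂ (u i) (A' (u i))).re := by
          rw [← Complex.neg_re, ← h4]
          norm_cast
        simp only [RCLike.re_eq_complex_re] at h3
        have h6 : ‖A' (u i)‖ ^ 2 = 0 := le_antisymm (by linarith) (sq_nonneg _)
        simpa using h6
      refine ⟨0, 0, by simpa using h1, ?_⟩
      rw [h1, zero_sub, neg_inj] at hu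
      rw [h1, hu, zero_add] at hs
      simpa using hs
  choose α β hα hβ using key
  have nonneg_of : ∀ {T : H →L[ℂ] H} {γ : Fin (Module.finrank ℂ H) → ℝ}, T.IsPositive →
      (∀ i, T (u i) = (γ i : ℂ) • u i) → ∀ i, 0 ≤ γ i := by
    intro T γ hT h i
    have := hT.re_inner_nonneg_right (u i)
    rw [h, inner_smul_right, u.inner_eq_one] at this
    simpa using this
  let e : H ≃ₗ[ℂ] H := LinearEquiv.ofLinearMap R.toLinearMap D.toLinearMap
    (LinearMap.ext fun x => congrArg (fun T : H →L[ℂ] H => T x) hRD)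
    (LinearMap.ext fun x => congrArg (fun T : H →L[ℂ] H => T x) hDR)
  have hv : ⇑(u.toBasis.map e) = fun i => R (u i) := by
    ext i; simp [e]
  refine ⟨u.toBasis.map e, α, β, nonneg_of hA' hα, nonneg_of hB' hβ, ?_, ?_⟩
  · rw [hv, ← diagOp_conj R hRs, ← eq_diagOp_of_apply_eq u hα, hAR]
  · rw [hv, ← diagOp_conj R hRs, ← eq_diagOp_of_apply_eq u hβ, hBR]

-- This is the Löwner-Heinz inequality: `x ^ t` is operator monotone for `0 ≤ t ≤ 1`.
omit [FiniteDimensional ℂ H] in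
theorem geomMean_mono_right {t : ℝ} (ht : t ∈ Set.Icc (0 : ℝ) 1) (B : H →L[ℂ] H)
    {A A' : H →L[ℂ] H} (h : A ≤ A') : geomMean t B A ≤ geomMean t B A' := by
  unfold geomMean
  have h1 : IsSelfAdjoint (B ^ (1 / 2 : ℝ)) := CFC.rpow_nonneg.isSelfAdjoint
  have h2 : IsSelfAdjoint (B ^ (-1 / 2 : ℝ)) := CFC.rpow_nonneg.isSelfAdjoint
  exact h1.conjugate_le_conjugate (CFC.rpow_le_rpow ht (h2.conjugate_le_conjugate h))

theorem pos_of_isStrictlyPositive_diagOp (v : Module.Basis ι ℂ H) {α : ι → ℝ}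
    (h : IsStrictlyPositive (diagOp v α)) (i : ι) : 0 < α i := by
  obtain ⟨w, -, h1, h0, -⟩ := exists_inner_dual v
  have hw : diagOp v α (w i) = (α i : ℂ) • v i := by
    rw [diagOp_apply, Finset.sum_eq_single i]
    · rw [h1, one_smul]
    · intro j _ hj
      rw [h0 _ _ hj, zero_smul, smul_zero]
    · simp
  have hn : 0 ≤ α i := by
    have := ((ContinuousLinearMap.nonneg_iff_isPositive _).1 h.nonneg).re_inner_nonneg_right (w i)
    rw [hw, inner_smul_right, ← inner_conj_symm, h1] at this
    simpa using this
  refine lt_of_le_of_ne hn fun h2 => ?_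
  rw [← h2, Complex.ofReal_zero, zero_smul] at hw
  have h3 := (ContinuousLinearMap.isUnit_iff_isUnit_toLinearMap).1 h.isUnit
  rw [LinearMap.isUnit_iff_ker_eq_bot, LinearMap.ker_eq_bot'] at h3
  have h4 := h3 (w i) hw
  have h5 := h1 i
  rw [h4, inner_zero_right] at h5
  exact zero_ne_one h5

/-- The formula in a common basis is symmetric; this transfers monotonicity from one argument of the
mean to the other. -/
theorem geomMean_comm {A B : H →L[ℂ] H} (hA : IsStrictlyPositive A) (hB : IsStrictlyPositive B)
    (t : ℝ) : geomMean t B A = geomMean (1 - t) A B := by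
  obtain ⟨v, α, β, -, -, rfl, rfl⟩ := exists_simultaneous_diagOp
    ((ContinuousLinearMap.nonneg_iff_isPositive _).1 hA.nonneg)
    ((ContinuousLinearMap.nonneg_iff_isPositive _).1 hB.nonneg)
  have hα := pos_of_isStrictlyPositive_diagOp v hA
  have hβ := pos_of_isStrictlyPositive_diagOp v hB
  rw [geomMean_diagOp v hα hβ, geomMean_diagOp v hβ hα]
  congr 1
  ext i
  rw [sub_sub_cancel, mul_comm]

theorem geomMean_mono {t : ℝ} (ht : t ∈ Set.Icc (0 : ℝ) 1) {A A' B B' : H →L[ℂ] H}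
    (hA : IsStrictlyPositive A) (hB : IsStrictlyPositive B) (hAA : A ≤ A') (hBB : B ≤ B') :
    geomMean t B A ≤ geomMean t B' A' := by
  have hA' := hA.of_le hAA
  have hB' := hB.of_le hBB
  calc geomMean t B A ≤ geomMean t B A' := geomMean_mono_right ht B hAA
    _ = geomMean (1 - t) A' B := geomMean_comm hA' hB t
    _ ≤ geomMean (1 - t) A' B' :=
      geomMean_mono_right ⟨by linarith [ht.2], by linarith [ht.1]⟩ A' hBB
    _ = geomMean t B' A' := (geomMean_comm hA' hB' t).symm

-- A squeeze in the Löwner order: the norm is monotone on positive operators.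
omit [FiniteDimensional ℂ H] in
theorem tendsto_of_le_of_le {l : Filter ℝ} {L M U : ℝ → H →L[ℂ] H} {G : H →L[ℂ] H}
    (hL : Tendsto L l (𝓝 G)) (hU : Tendsto U l (𝓝 G)) (hLM : ∀ᶠ x in l, L x ≤ M x)
    (hMU : ∀ᶠ x in l, M x ≤ U x) : Tendsto M l (𝓝 G) := by
  have h1 : Tendsto (fun x => M x - L x) l (𝓝 0) := by
    refine squeeze_zero_norm' (a := fun x => ‖U x - L x‖) ?_ ?_
    · filter_upwards [hLM, hMU] with x h2 h3
      exact CStarAlgebra.norm_le_norm_of_nonneg_of_le (sub_nonneg.2 h2) (sub_le_sub_right h3 _)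
    · have := (hU.sub hL).norm
      simpa using this
  simpa using h1.add hL

omit [FiniteDimensional ℂ H] [CompleteSpace H] in
theorem tendsto_diagOp (v : ι → H) {l : Filter ℝ} {γ : ℝ → ι → ℝ} {γ₀ : ι → ℝ}
    (h : ∀ i, Tendsto (fun x => γ x i) l (𝓝 (γ₀ i))) :
    Tendsto (fun x => diagOp v (γ x)) l (𝓝 (diagOp v γ₀)) := by
  unfold diagOp
  exact tendsto_finsetSum _ fun i _ =>
    ((Complex.continuous_ofReal.tendsto _).comp (h i)).smul tendsto_const_nhds

omit [FiniteDimensional ℂ H] [CompleteSpace H] in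
theorem smul_le_smul_of_le {x : ℝ} (hx : 0 ≤ x) {S T : H →L[ℂ] H} (h : S ≤ T) :
    (x : ℂ) • S ≤ (x : ℂ) • T := by
  rw [ContinuousLinearMap.le_def, ← smul_sub]
  exact ((ContinuousLinearMap.le_def _ _).1 h).smul_of_nonneg (by exact_mod_cast hx)

/-- The perturbation `ε I` in the Kubo-Ando limit is not diagonal in `v`; these bounds trap it
between two perturbations that are. -/
theorem exists_diagOp_one_bounds (v : Module.Basis ι ℂ H) : ∃ c d : ℝ, 0 < c ∧ 0 < d ∧
    (c : ℂ) • diagOp v (fun _ => 1) ≤ 1 ∧ 1 ≤ (d : ℂ) • diagOp v (fun _ => 1) := by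
  have hp := diagOp_isStrictlyPositive v (α := fun _ => 1) fun _ => zero_lt_one
  set T := diagOp v (fun _ => 1)
  by_cases! hn : Nontrivial (H →L[ℂ] H)
  · have alg : ∀ r : ℝ, algebraMap ℝ (H →L[ℂ] H) r = (r : ℂ) • 1 := fun r => by
      rw [Algebra.algebraMap_eq_smul_one]; rfl
    have hinv : ∀ {r : ℝ}, 0 < r → ∀ S : H →L[ℂ] H, ((r⁻¹ : ℝ) : ℂ) • (r : ℂ) • S = S := by
      intro r hr S
      rw [smul_smul, ← Complex.ofReal_mul, inv_mul_cancel₀ hr.ne', Complex.ofReal_one, one_smul]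
    obtain ⟨r, hr, hrT⟩ := (CFC.exists_pos_algebraMap_le_iff hp.isSelfAdjoint).2
      fun x hx => hp.spectrum_pos hx
    have hT : 0 < ‖T‖ := norm_pos_iff.2 hp.isUnit.ne_zero
    have hTn := hp.isSelfAdjoint.le_algebraMap_norm_self
    rw [alg] at hTn hrT
    refine ⟨‖T‖⁻¹, r⁻¹, inv_pos.2 hT, inv_pos.2 hr, ?_, ?_⟩
    · have := smul_le_smul_of_le (inv_pos.2 hT).le hTn
      rwa [hinv hT] at this
    · have := smul_le_smul_of_le (inv_pos.2 hr).le hrT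
      rwa [hinv hr] at this
  · exact ⟨1, 1, zero_lt_one, zero_lt_one, (Subsingleton.elim _ _).le,
      (Subsingleton.elim _ _).le⟩

theorem isKuboAndoMean_diagOp (v : Module.Basis ι ℂ H) {α β : ι → ℝ} (hα : ∀ i, 0 ≤ α i)
    (hβ : ∀ i, 0 ≤ β i) {t : ℝ} (ht : t ∈ Set.Icc (0 : ℝ) 1) :
    IsKuboAndoMean t (diagOp v β) (diagOp v α) (diagOp v fun i => α i ^ t * β i ^ (1 - t)) := by
  obtain ⟨c, d, hc, hd, hc1, hd1⟩ := exists_diagOp_one_bounds v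
  have hrw : ∀ (γ : ι → ℝ) (x : ℝ), diagOp v (fun i => γ i + x) =
      diagOp v γ + (x : ℂ) • diagOp v (fun _ => 1) := by
    intro γ x
    rw [← diagOp_smul, ← diagOp_add]
    simp
  have hlow : ∀ (γ : ι → ℝ) {x : ℝ}, 0 < x →
      diagOp v (fun i => γ i + x * c) ≤ diagOp v γ + (x : ℂ) • 1 := by
    intro γ x hx
    rw [hrw, Complex.ofReal_mul, mul_smul]
    gcongr
    exact smul_le_smul_of_le hx.le hc1
  have hup : ∀ (γ : ι → ℝ) {x : ℝ}, 0 < x →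
      diagOp v γ + (x : ℂ) • 1 ≤ diagOp v (fun i => γ i + x * d) := by
    intro γ x hx
    rw [hrw, Complex.ofReal_mul, mul_smul]
    gcongr
    exact smul_le_smul_of_le hx.le hd1
  have hlim : ∀ k : ℝ, Tendsto (fun x : ℝ => diagOp v fun i =>
      (α i + x * k) ^ t * (β i + x * k) ^ (1 - t)) (𝓝[>] 0)
      (𝓝 (diagOp v fun i => α i ^ t * β i ^ (1 - t))) := by
    intro k
    refine tendsto_diagOp v fun i => ?_
    have h1 : ∀ a : ℝ, Tendsto (fun x : ℝ => a + x * k) (𝓝[>] 0) (𝓝 a) := fun a => by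
      have : ContinuousAt (fun x : ℝ => a + x * k) 0 := by fun_prop
      simpa [ContinuousAt] using this.tendsto.mono_left nhdsWithin_le_nhds
    exact ((h1 _).rpow_const (Or.inr ht.1)).mul
      ((h1 _).rpow_const (Or.inr (by linarith [ht.2])))
  have hpos : ∀ {γ : ι → ℝ}, (∀ i, 0 ≤ γ i) → ∀ {x k : ℝ}, 0 < x → 0 < k →
      ∀ i, 0 < γ i + x * k := fun hγ _ _ hx hk i => add_pos_of_nonneg_of_pos (hγ i) (mul_pos hx hk)
  refine tendsto_of_le_of_le (hlim c) (hlim d) ?_ ?_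
  · filter_upwards [self_mem_nhdsWithin] with x (hx : 0 < x)
    rw [← geomMean_diagOp v (hpos hα hx hc) (hpos hβ hx hc)]
    exact geomMean_mono ht (diagOp_isStrictlyPositive v (hpos hα hx hc))
      (diagOp_isStrictlyPositive v (hpos hβ hx hc)) (hlow α hx) (hlow β hx)
  · filter_upwards [self_mem_nhdsWithin] with x (hx : 0 < x)
    rw [← geomMean_diagOp v (hpos hα hx hd) (hpos hβ hx hd)]
    exact geomMean_mono ht
      ((diagOp_isStrictlyPositive v (hpos hα hx hc)).of_le (hlow α hx))
      ((diagOp_isStrictlyPositive v (hpos hβ hx hc)).of_le (hlow β hx)) (hup α hx) (hup β hx)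

end GeomMean

/-! ### Tensor powers of diagonal operators and traces -/

section OpPower

variable {H : Type*} [NormedAddCommGroup H] [InnerProductSpace ℂ H] [FiniteDimensional ℂ H]
  {ι : Type*} [Fintype ι]

theorem opPower_diagOp [DecidableEq ι] (v : ι → H) (α : ι → ℝ) (n : ℕ) (z : HilbertPower H n) :
    opPower (diagOp v α) n z =
      diagOp (fun f : Fin n → ι => pureTensor fun k => v (f k)) (fun f => ∏ k, α (f k)) z := by
  suffices h : opPower (diagOp v α) n =
      (diagOp (fun f : Fin n → ι => pureTensor fun k => v (f k))
        (fun f => ∏ k, α (f k))).toLinearMap from congrArg (fun T => T z) h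
  refine PiTensorProduct.ext (MultilinearMap.ext fun x => ?_)
  change opPower (diagOp v α) n (pureTensor x) = diagOp _ _ (pureTensor x)
  rw [opPower_pureTensor, diagOp_apply]
  simp only [diagOp_apply, inner_pureTensor, smul_smul]
  refine (MultilinearMap.map_sum (PiTensorProduct.tprod ℂ) _).trans ?_
  refine Finset.sum_congr rfl fun f _ => ?_
  refine (MultilinearMap.map_smul_univ (PiTensorProduct.tprod ℂ) _ _).trans ?_
  rw [Finset.prod_mul_distrib, Complex.ofReal_prod]
  rfl

theorem opPower_diagOp' [DecidableEq ι] (v : ι → H) (α : ι → ℝ) (n : ℕ) :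
    opPower (diagOp v α) n = (diagOp (fun f : Fin n → ι => pureTensor fun k => v (f k))
        (fun f => ∏ k, α (f k))).toLinearMap :=
  LinearMap.ext fun z => opPower_diagOp v α n z

/-- For positive `X` this writes the trace as a sum with the nonnegative weights `⟨v_f, X v_f⟩`,
which do not depend on `α`. -/
theorem powTr_diagOp [DecidableEq ι] (v : ι → H) (α : ι → ℝ) (n : ℕ)
    (X : HilbertPower H n →ₗ[ℂ] HilbertPower H n) :
    powTr (diagOp v α) n X = ∑ f : Fin n → ι, (∏ k, α (f k)) *
      (inner ℂ (pureTensor fun k => v (f k)) (X (pureTensor fun k => v (f k)))).re := by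
  have hr : ∀ y : HilbertPower H n, LinearMap.trace ℂ (HilbertPower H n)
      ((rankOne ℂ y y).toLinearMap ∘ₗ X) = inner ℂ y (X y) := by
    intro y
    rw [LinearMap.trace_comp_comm']
    have : X ∘ₗ (rankOne ℂ y y).toLinearMap = (rankOne ℂ (X y) y).toLinearMap := by
      ext z; simp
    rw [this, trace_rankOne]
  have hs : ∀ F : (Fin n → ι) → HilbertPower H n →ₗ[ℂ] HilbertPower H n,
      (∑ f, F f) ∘ₗ X = ∑ f, F f ∘ₗ X := fun F => Finset.sum_mul (R := Module.End ℂ _) _ F X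
  unfold powTr
  rw [opPower_diagOp']
  simp only [diagOp, hs, ContinuousLinearMap.toLinearMap_sum, ContinuousLinearMap.toLinearMap_smul,
    LinearMap.smul_comp, map_sum, map_smul, hr, Complex.re_sum, smul_eq_mul,
    Complex.re_ofReal_mul]

theorem powTr_nonneg [CompleteSpace H] {A : H →L[ℂ] H} (hA : A.IsPositive) (n : ℕ)
    {X : HilbertPower H n →ₗ[ℂ] HilbertPower H n} (hX : X.IsPositive) : 0 ≤ powTr A n X := by
  classical
  -- Pairing `A` with itself yields a diagonal form of `A` alone.
  obtain ⟨v, α, -, hα, -, rfl, -⟩ := exists_simultaneous_diagOp hA hA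
  rw [powTr_diagOp]
  exact Finset.sum_nonneg fun f _ => mul_nonneg (Finset.prod_nonneg fun _ _ => hα _)
    (hX.re_inner_nonneg_right _)

/-- In a basis common to `C` and `G` the order holds coefficientwise, hence also for products of the
nonnegative coefficients. -/
theorem powTr_mono [CompleteSpace H] {C G : H →L[ℂ] H} (hC : C.IsPositive) (h : C ≤ G) (n : ℕ)
    {X : HilbertPower H n →ₗ[ℂ] HilbertPower H n} (hX : X.IsPositive) :
    powTr C n X ≤ powTr G n X := by
  classical
  have hG : G.IsPositive := by
    rw [← ContinuousLinearMap.nonneg_iff_isPositive] at hC ⊢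
    exact hC.trans h
  obtain ⟨v, α, β, hα, hβ, rfl, rfl⟩ := exists_simultaneous_diagOp hC hG
  rw [powTr_diagOp, powTr_diagOp]
  exact Finset.sum_le_sum fun f _ => mul_le_mul_of_nonneg_right
    (Finset.prod_le_prod (fun k _ => hα _) fun k _ => le_of_diagOp_le v h _)
    (hX.re_inner_nonneg_right _)

theorem opPower_isPositive [CompleteSpace H] {A : H →L[ℂ] H} (hA : A.IsPositive) (n : ℕ) :
    (opPower A n).IsPositive := by
  classical
  obtain ⟨v, α, -, hα, -, rfl, -⟩ := exists_simultaneous_diagOp hA hA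
  rw [opPower_diagOp', ContinuousLinearMap.isPositive_toLinearMap_iff]
  exact diagOp_isPositive _ fun f => Finset.prod_nonneg fun _ _ => hα _

theorem powTr_rankOne (A : H →L[ℂ] H) (n : ℕ) (z : HilbertPower H n) :
    powTr A n (rankOne ℂ z z).toLinearMap = (inner ℂ z (opPower A n z)).re := by
  unfold powTr
  have : opPower A n ∘ₗ (rankOne ℂ z z).toLinearMap =
      (rankOne ℂ (opPower A n z) z).toLinearMap := by
    ext y; simp
  rw [this, trace_rankOne]

omit [FiniteDimensional ℂ H] in
theorem powTr_add (A : H →L[ℂ] H) (n : ℕ) (X Y : HilbertPower H n →ₗ[ℂ] HilbertPower H n) :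
    powTr A n (X + Y) = powTr A n X + powTr A n Y := by
  simp [powTr, LinearMap.comp_add]

theorem opPower_mono [CompleteSpace H] {C G : H →L[ℂ] H} (hC : C.IsPositive) (h : C ≤ G) (n : ℕ) :
    opPower C n ≤ opPower G n := by
  classical
  have hG : G.IsPositive := by
    rw [← ContinuousLinearMap.nonneg_iff_isPositive] at hC ⊢
    exact hC.trans h
  obtain ⟨v, α, β, hα, hβ, rfl, rfl⟩ := exists_simultaneous_diagOp hC hG
  rw [opPower_diagOp', opPower_diagOp', ContinuousLinearMap.coe_le_coe_iff]
  exact diagOp_mono _ fun f => Finset.prod_le_prod (fun k _ => hα _) fun k _ => le_of_diagOp_le v h _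

end OpPower

/-! ### Separation for semigroups in the plane and in the octant -/

/-- The number `t` separates the slopes `a.2 / a.1` of points in the right half-plane from those in
the left one. If a right slope exceeded a left one, an integer combination nearly cancelling the
first coordinate would have an arbitrarily large second coordinate. -/
theorem exists_mem_Icc_forall_le_mul {K : Set (ℝ × ℝ)}
    (hadd : ∀ a ∈ K, ∀ b ∈ K, a + b ∈ K) (hK : ∀ a ∈ K, a.2 ≤ max 0 a.1) :
    ∃ t ∈ Set.Icc (0 : ℝ) 1, ∀ a ∈ K, a.2 ≤ t * a.1 := by
  have hmul : ∀ (m : ℕ), 1 ≤ m → ∀ a ∈ K, m • a ∈ K := by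
    intro m hm a ha
    induction m, hm using Nat.le_induction with
    | base => simpa using ha
    | succ m _ ih => rw [succ_nsmul]; exact hadd _ ih _ ha
  have hpair : ∀ a ∈ K, ∀ b ∈ K, 0 < a.1 → b.1 < 0 → a.2 / a.1 ≤ b.2 / b.1 := by
    intro a ha b hb ha1 hb1
    by_contra! hlt
    have hδ : 0 < -b.1 * a.2 + a.1 * b.2 := by
      rw [← neg_div_neg_eq b.2, div_lt_div_iff₀ (neg_pos.2 hb1) ha1] at hlt
      linarith
    -- The ideal multiplicities are `-N b.1` and `N a.1`. Rounding them up costs at most `a.1` in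
    -- the first coordinate and `|a.2| + |b.2|` in the second; `N` is chosen to outweigh both.
    obtain ⟨N, hN⟩ := exists_nat_gt
      (max 1 ((a.1 + |a.2| + |b.2|) / (-b.1 * a.2 + a.1 * b.2)))
    have hN0 : (0 : ℝ) < N := lt_of_lt_of_le zero_lt_one ((le_max_left _ _).trans hN.le)
    have hN1 := (le_max_right _ _).trans_lt hN
    rw [div_lt_iff₀ hδ] at hN1
    have pm : (0 : ℝ) < N * -b.1 := mul_pos hN0 (neg_pos.2 hb1)
    have pm' : (0 : ℝ) < N * a.1 := mul_pos hN0 ha1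
    have key := hK _ (hadd _ (hmul ⌈N * -b.1⌉₊ (Nat.one_le_ceil_iff.2 pm) a ha) _
      (hmul ⌈N * a.1⌉₊ (Nat.one_le_ceil_iff.2 pm') b hb))
    simp only [Prod.fst_add, Prod.snd_add, Prod.smul_fst, Prod.smul_snd] at key
    simp only [nsmul_eq_mul] at key
    have m1 := Nat.le_ceil (N * -b.1)
    have m2 := (Nat.ceil_lt_add_one pm.le).le
    have m1' := Nat.le_ceil (N * a.1)
    have m2' := (Nat.ceil_lt_add_one pm'.le).le
    set m : ℝ := (⌈N * -b.1⌉₊ : ℝ)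
    set m' : ℝ := (⌈N * a.1⌉₊ : ℝ)
    have near : ∀ c d y : ℝ, c ≤ d → d ≤ c + 1 → c * y - |y| ≤ d * y := by
      intro c d y h1 h2
      have h3 : |(d - c) * y| ≤ 1 * |y| := by
        rw [abs_mul]
        exact mul_le_mul_of_nonneg_right (abs_le.2 ⟨by linarith, by linarith⟩) (abs_nonneg _)
      linarith [neg_abs_le ((d - c) * y)]
    have k1 := near _ _ a.2 m1 m2
    have k2 := near _ _ b.2 m1' m2'
    have k3 : max 0 (m * a.1 + m' * b.1) ≤ a.1 :=
      max_le ha1.le (by nlinarith)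
    linarith
  -- Including `0` makes `T` nonempty and its supremum nonnegative, even if no point lies to the
  -- right.
  let T : Set ℝ := {s | s = 0 ∨ ∃ a ∈ K, 0 < a.1 ∧ s = a.2 / a.1}
  have hT1 : ∀ s ∈ T, s ≤ 1 := by
    rintro s (rfl | ⟨a, ha, ha1, rfl⟩)
    · exact zero_le_one
    · rw [div_le_one ha1]
      exact (hK a ha).trans (max_le ha1.le le_rfl)
  have hTb : BddAbove T := ⟨1, hT1⟩
  have hT0 : (0 : ℝ) ∈ T := Or.inl rfl
  refine ⟨sSup T, ⟨le_csSup hTb hT0, csSup_le ⟨0, hT0⟩ hT1⟩, fun a ha => ?_⟩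
  rcases lt_trichotomy a.1 0 with h | h | h
  · have h2 : sSup T ≤ a.2 / a.1 := by
      refine csSup_le ⟨0, hT0⟩ ?_
      rintro s (rfl | ⟨b, hb, hb1, rfl⟩)
      · have := hK a ha
        rw [max_eq_left h.le] at this
        exact div_nonneg_of_nonpos this h.le
      · exact hpair b hb a ha hb1 h
    rwa [le_div_iff_of_neg h] at h2
  · have := hK a ha
    rw [h] at this ⊢
    simpa using this
  · rw [← div_le_iff₀ h]
    exact le_csSup hTb (Or.inr ⟨a, ha, h, rfl⟩)

theorem le_of_forall_mul_pow_le {y b c d : ℝ} (hy : 0 < y) (hc : 0 ≤ c) (hd : 0 ≤ d)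
    (h : ∀ m : ℕ, y * c ^ m ≤ b * d ^ m) : c ≤ d := by
  by_contra! hlt
  have h1 : Tendsto (fun m : ℕ => b * (d / c) ^ m) atTop (𝓝 (b * 0)) :=
    (tendsto_pow_atTop_nhds_zero_of_lt_one (div_nonneg hd hc)
      ((div_lt_one (hd.trans_lt hlt)).2 hlt)).const_mul b
  have h2 : y ≤ b * 0 := ge_of_tendsto' h1 fun m => by
    rw [div_pow, ← mul_div_assoc, le_div_iff₀ (pow_pos (hd.trans_lt hlt) m)]
    exact h m
  linarith

/-- For a triple `(a, b, c)` with positive entries, the planar separation applies to `(log a - log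
b, log c - log b)`. -/
theorem exists_mem_Icc_forall_le_rpow_mul_rpow {K : Set (ℝ × ℝ × ℝ)}
    (hmul : ∀ p ∈ K, ∀ q ∈ K, p * q ∈ K) (h0 : ∀ p ∈ K, 0 ≤ p.1 ∧ 0 ≤ p.2.1 ∧ 0 ≤ p.2.2)
    (hK : ∀ p ∈ K, p.2.2 ≤ max p.1 p.2.1) :
    ∃ t ∈ Set.Icc (0 : ℝ) 1, ∀ p ∈ K, p.2.2 ≤ p.1 ^ t * p.2.1 ^ (1 - t) := by
  have hpow : ∀ p ∈ K, ∀ q ∈ K, ∀ m : ℕ, p * q ^ m ∈ K := by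
    intro p hp q hq m
    induction m with
    | zero => simpa using hp
    | succ m ih => rw [pow_succ, ← mul_assoc]; exact hmul _ ih _ hq
  -- If a triple has `a = 0 < c`, then `t = 0` works: multiplying it by the powers of any `q` leaves
  -- only the second entry in the maximum, and the constants disappear in the limit.
  by_cases hA : ∃ p ∈ K, p.1 = 0 ∧ 0 < p.2.2
  · obtain ⟨p, hp, hp1, hp2⟩ := hA
    refine ⟨0, ⟨le_rfl, zero_le_one⟩, fun q hq => ?_⟩
    rw [Real.rpow_zero, one_mul, sub_zero, Real.rpow_one]
    refine le_of_forall_mul_pow_le hp2 (h0 q hq).2.2 (h0 q hq).2.1 (b := p.2.1) fun m => ?_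
    have := hK _ (hpow p hp q hq m)
    have hn := (h0 _ (hpow p hp q hq m)).2.1
    simp only [Prod.fst_mul, Prod.snd_mul, hp1, zero_mul] at this hn
    rwa [max_eq_right hn] at this
  by_cases hB : ∃ p ∈ K, p.2.1 = 0 ∧ 0 < p.2.2
  · obtain ⟨p, hp, hp1, hp2⟩ := hB
    refine ⟨1, ⟨zero_le_one, le_rfl⟩, fun q hq => ?_⟩
    rw [sub_self, Real.rpow_zero, mul_one, Real.rpow_one]
    refine le_of_forall_mul_pow_le hp2 (h0 q hq).2.2 (h0 q hq).1 (b := p.1) fun m => ?_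
    have := hK _ (hpow p hp q hq m)
    have hn := (h0 _ (hpow p hp q hq m)).1
    simp only [Prod.fst_mul, Prod.snd_mul, hp1, zero_mul] at this hn
    rwa [max_eq_left hn] at this
  push Not at hA hB
  have hpos : ∀ p ∈ K, 0 < p.2.2 → 0 < p.1 ∧ 0 < p.2.1 := fun p hp h =>
    ⟨lt_of_le_of_ne (h0 p hp).1 fun h1 => (hA p hp h1.symm).not_gt h,
      lt_of_le_of_ne (h0 p hp).2.1 fun h1 => (hB p hp h1.symm).not_gt h⟩
  obtain ⟨t, ht, h⟩ := exists_mem_Icc_forall_le_mul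
    (K := {a | ∃ p ∈ K, 0 < p.2.2 ∧ a = (Real.log p.1 - Real.log p.2.1,
      Real.log p.2.2 - Real.log p.2.1)}) (by
    rintro _ ⟨p, hp, hp2, rfl⟩ _ ⟨q, hq, hq2, rfl⟩
    refine ⟨p * q, hmul p hp q hq, mul_pos hp2 hq2, ?_⟩
    obtain ⟨p1, p3⟩ := hpos p hp hp2
    obtain ⟨q1, q3⟩ := hpos q hq hq2
    simp only [Prod.fst_mul, Prod.snd_mul]
    rw [Real.log_mul p1.ne' q1.ne', Real.log_mul p3.ne' q3.ne', Real.log_mul hp2.ne' hq2.ne']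
    ext <;> simp <;> ring) (by
    rintro _ ⟨p, hp, hp2, rfl⟩
    obtain ⟨p1, p3⟩ := hpos p hp hp2
    rcases le_max_iff.1 (hK p hp) with h | h
    · refine le_max_of_le_right (sub_le_sub_right (Real.log_le_log hp2 h) _)
    · refine le_max_of_le_left (sub_nonpos.2 (Real.log_le_log hp2 h)))
  refine ⟨t, ht, fun p hp => ?_⟩
  rcases (h0 p hp).2.2.eq_or_lt with h1 | h1
  · rw [← h1]
    exact mul_nonneg (Real.rpow_nonneg (h0 p hp).1 _) (Real.rpow_nonneg (h0 p hp).2.1 _)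
  · obtain ⟨p1, p3⟩ := hpos p hp h1
    have h2 := h _ ⟨p, hp, h1, rfl⟩
    simp only at h2
    rw [← Real.log_le_log_iff h1 (by positivity), Real.log_mul (by positivity) (by positivity),
      Real.log_rpow p1, Real.log_rpow p3]
    linarith

/-! ### Quadratic forms on tensor powers and the method of types -/

section TensorForm

variable {ι κ : Type*} [Fintype ι] [Fintype κ]

/-- The quadratic form `z ↦ ‖S^{⊗n} z‖²` in coordinates. -/
noncomputable def tensorForm (S : κ → ι → ℂ) (n : ℕ) (z : (Fin n → ι) → ℂ) : ℝ :=
  ∑ h : Fin n → κ, ‖∑ f : Fin n → ι, (∏ k, S (h k) (f k)) * z f‖ ^ 2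

/-- The tensor product of two vectors in coordinates. -/
def tensorVec {m n : ℕ} (z : (Fin m → ι) → ℂ) (w : (Fin n → ι) → ℂ) (f : Fin (m + n) → ι) : ℂ :=
  z (fun k => f (Fin.castAdd n k)) * w (fun k => f (Fin.natAdd m k))

theorem sum_append {M : Type*} [AddCommMonoid M] {m n : ℕ}
    (F : (Fin (m + n) → ι) → M) :
    ∑ f, F f = ∑ g : Fin m → ι, ∑ h : Fin n → ι, F (Fin.append g h) := by
  rw [← Fintype.sum_prod_type', ← (Fin.appendEquiv m n).sum_comp]
  rfl

omit [Fintype ι] in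
theorem tensorVec_append {m n : ℕ} (z : (Fin m → ι) → ℂ) (w : (Fin n → ι) → ℂ)
    (g : Fin m → ι) (h : Fin n → ι) : tensorVec z w (Fin.append g h) = z g * w h := by
  simp [tensorVec]

theorem sum_norm_sq_tensorVec {m n : ℕ} (z : (Fin m → ι) → ℂ) (w : (Fin n → ι) → ℂ) :
    ∑ f, ‖tensorVec z w f‖ ^ 2 = (∑ f, ‖z f‖ ^ 2) * ∑ f, ‖w f‖ ^ 2 := by
  rw [sum_append, Finset.sum_mul_sum]
  simp only [tensorVec_append, norm_mul, mul_pow]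

theorem tensorForm_tensorVec (S : κ → ι → ℂ) {m n : ℕ} (z : (Fin m → ι) → ℂ)
    (w : (Fin n → ι) → ℂ) :
    tensorForm S (m + n) (tensorVec z w) = tensorForm S m z * tensorForm S n w := by
  unfold tensorForm
  rw [sum_append, Finset.sum_mul_sum]
  refine Finset.sum_congr rfl fun g _ => Finset.sum_congr rfl fun h _ => ?_
  rw [← mul_pow, ← norm_mul, sum_append, Finset.sum_mul_sum]
  simp only [tensorVec_append, Fin.prod_univ_add, Fin.append_left, Fin.append_right]
  congr 2
  refine Finset.sum_congr rfl fun a _ => Finset.sum_congr rfl fun b _ => ?_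
  ring

theorem tensorForm_nonneg (S : κ → ι → ℂ) (n : ℕ) (z : (Fin n → ι) → ℂ) :
    0 ≤ tensorForm S n z :=
  Finset.sum_nonneg fun _ _ => sq_nonneg _

theorem tensorForm_sum_le (S : κ → ι → ℂ) (n : ℕ) {σ : Type*} [Fintype σ]
    (z : σ → (Fin n → ι) → ℂ) :
    tensorForm S n (fun f => ∑ s, z s f) ≤ Fintype.card σ * ∑ s, tensorForm S n (z s) := by
  unfold tensorForm
  rw [Finset.sum_comm, Finset.mul_sum]
  refine Finset.sum_le_sum fun h _ => ?_
  have h1 : ∑ f : Fin n → ι, (∏ k, S (h k) (f k)) * ∑ s, z s f =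
      ∑ s, ∑ f : Fin n → ι, (∏ k, S (h k) (f k)) * z s f := by
    rw [Finset.sum_comm]
    simp only [Finset.mul_sum]
  rw [h1]
  calc _ ≤ (∑ s, ‖∑ f : Fin n → ι, (∏ k, S (h k) (f k)) * z s f‖) ^ 2 := by
        gcongr; exact norm_sum_le _ _
    _ ≤ _ := sq_sum_le_card_mul_sum_sq

theorem sum_prod_eq_pow [DecidableEq ι] {R : Type*} [CommSemiring R] (n : ℕ) (c : ι → R) :
    ∑ f : Fin n → ι, ∏ k, c (f k) = (∑ i, c i) ^ n := by
  rw [← Fintype.prod_sum (fun (_ : Fin n) i => c i)]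
  simp

theorem tensorForm_prod [DecidableEq ι] [DecidableEq κ] (S : κ → ι → ℂ) (n : ℕ) (x : ι → ℂ) :
    tensorForm S n (fun f => ∏ k, x (f k)) = (∑ k, ‖∑ i, S k i * x i‖ ^ 2) ^ n := by
  unfold tensorForm
  rw [← sum_prod_eq_pow]
  refine Finset.sum_congr rfl fun h _ => ?_
  simp only [← Finset.prod_mul_distrib]
  rw [← Fintype.prod_sum (fun k i => S (h k) i * x i), norm_prod, Finset.prod_pow]

/-- The number of occurrences of each index in a word. -/
def wordType [DecidableEq ι] {n : ℕ} (f : Fin n → ι) (i : ι) : Fin (n + 1) :=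
  ⟨(Finset.univ.filter fun k => f k = i).card,
    Nat.lt_succ_of_le ((Finset.card_filter_le _ _).trans (Finset.card_fin n).le)⟩

theorem prod_eq_of_wordType_eq [DecidableEq ι] {n : ℕ} {f g : Fin n → ι}
    (h : wordType f = wordType g) (α : ι → ℝ) : ∏ k, α (f k) = ∏ k, α (g k) := by
  have h1 : ∀ f : Fin n → ι, ∏ k, α (f k) = ∏ i, α i ^ (wordType f i : ℕ) := by
    intro f
    rw [← Finset.prod_fiberwise Finset.univ f]
    refine Finset.prod_congr rfl fun i _ => ?_
    rw [Finset.prod_congr rfl (fun k hk => by rw [(Finset.mem_filter.1 hk).2]),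
      Finset.prod_const]
    rfl
  rw [h1, h1, h]

/-- A polynomial factor cannot compensate the geometric decay of `(V / U) ^ n`. -/
theorem le_of_forall_pow_le_mul_pow {U V : ℝ} (hU : 0 ≤ U) (hV : 0 ≤ V) (d : ℕ)
    (h : ∀ n : ℕ, 1 ≤ n → U ^ n ≤ ((n : ℝ) + 1) ^ d * V ^ n) : U ≤ V := by
  by_contra! hlt
  have hU' : 0 < U := hV.trans_lt hlt
  have h1 : Tendsto (fun n : ℕ => ((n : ℝ)) ^ d * (V / U) ^ n) atTop (𝓝 0) :=
    tendsto_pow_const_mul_const_pow_of_abs_lt_one d (by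
      rw [abs_of_nonneg (div_nonneg hV hU)]
      exact (div_lt_one hU').2 hlt)
  have h2 := h1.comp (tendsto_add_atTop_nat 1)
  have h3 : V / U ≤ 0 := by
    refine ge_of_tendsto h2 ?_
    filter_upwards [eventually_ge_atTop 1] with n hn
    have h4 : (1 : ℝ) ≤ ((n : ℝ) + 1) ^ d * (V / U) ^ n := by
      rw [div_pow, ← mul_div_assoc, one_le_div (pow_pos hU' n)]
      exact h n hn
    simp only [Function.comp_apply, Nat.cast_add, Nat.cast_one, pow_succ]
    rw [← mul_assoc]
    exact le_mul_of_one_le_left (div_nonneg hV hU) h4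
  have h5 : V = 0 := by
    rw [div_le_iff₀ hU', zero_mul] at h3
    exact le_antisymm h3 hV
  have h6 := h 1 le_rfl
  rw [h5] at h6
  simp at h6
  linarith

theorem exists_tensorForm_le_rpow (S : κ → ι → ℂ) {α β : ι → ℝ} (hα : ∀ i, 0 ≤ α i)
    (hβ : ∀ i, 0 ≤ β i) {r : ℕ → ℝ}
    (hr : ∀ ε : ℝ, 0 < ε → ∀ᶠ n : ℕ in atTop, r n ≤ Real.exp (ε * n))
    (hS : ∀ n : ℕ, 1 ≤ n → ∀ z : (Fin n → ι) → ℂ, tensorForm S n z ≤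
      ∑ f : Fin n → ι, r n * max (∏ k, α (f k)) (∏ k, β (f k)) * ‖z f‖ ^ 2) :
    ∃ t ∈ Set.Icc (0 : ℝ) 1, ∀ x : ι → ℂ,
      ∑ k, ‖∑ i, S k i * x i‖ ^ 2 ≤ ∑ i, α i ^ t * β i ^ (1 - t) * ‖x i‖ ^ 2 := by
  classical
  -- The triple records the common weights `∏ α` and `∏ β` on the support of a nonzero `z`, and the
  -- Rayleigh quotient of the form at `z`.
  let P : ℕ → ℝ × ℝ × ℝ → Prop := fun n p => ∃ z : (Fin n → ι) → ℂ,
    (∀ f, z f ≠ 0 → ∏ k, α (f k) = p.1 ∧ ∏ k, β (f k) = p.2.1) ∧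
    0 < ∑ f, ‖z f‖ ^ 2 ∧ tensorForm S n z = p.2.2 * ∑ f, ‖z f‖ ^ 2
  have hPmul : ∀ {m n p q}, P m p → P n q → P (m + n) (p * q) := by
    rintro m n p q ⟨z, hz1, hz2, hz3⟩ ⟨w, hw1, hw2, hw3⟩
    refine ⟨tensorVec z w, fun f hf => ?_, ?_, ?_⟩
    · obtain ⟨h1, h2⟩ := hz1 _ (left_ne_zero_of_mul hf)
      obtain ⟨h3, h4⟩ := hw1 _ (right_ne_zero_of_mul hf)
      rw [Fin.prod_univ_add, Fin.prod_univ_add, h1, h2, h3, h4]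
      exact ⟨rfl, rfl⟩
    · rw [sum_norm_sq_tensorVec]; exact mul_pos hz2 hw2
    · rw [tensorForm_tensorVec, sum_norm_sq_tensorVec, hz3, hw3, Prod.snd_mul, Prod.snd_mul]
      ring
  have hP0 : ∀ {n p}, P n p → 0 ≤ p.1 ∧ 0 ≤ p.2.1 ∧ 0 ≤ p.2.2 := by
    rintro n p ⟨z, h1, h2, h3⟩
    obtain ⟨f, hf⟩ : ∃ f, z f ≠ 0 := by
      by_contra! h
      simp [h] at h2
    obtain ⟨h4, h5⟩ := h1 f hf
    refine ⟨h4 ▸ Finset.prod_nonneg fun _ _ => hα _, h5 ▸ Finset.prod_nonneg fun _ _ => hβ _, ?_⟩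
    have := tensorForm_nonneg S n z
    rw [h3] at this
    exact nonneg_of_mul_nonneg_left this h2
  have hPr : ∀ {n p}, 1 ≤ n → P n p → p.2.2 ≤ r n * max p.1 p.2.1 := by
    rintro n p hn ⟨z, h1, h2, h3⟩
    have h4 := hS n hn z
    have h5 : ∑ f : Fin n → ι, r n * max (∏ k, α (f k)) (∏ k, β (f k)) * ‖z f‖ ^ 2 =
        r n * max p.1 p.2.1 * ∑ f, ‖z f‖ ^ 2 := by
      rw [Finset.mul_sum]
      refine Finset.sum_congr rfl fun f _ => ?_
      by_cases hf : z f = 0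
      · simp [hf]
      · rw [(h1 f hf).1, (h1 f hf).2]
    rw [h3, h5] at h4
    exact le_of_mul_le_mul_right h4 h2
  have hPpow : ∀ {n p}, P n p → ∀ k : ℕ, P ((k + 1) * n) (p ^ (k + 1)) := by
    intro n p h k
    induction k with
    | zero => simpa using h
    | succ k ih =>
      rw [pow_succ, add_mul, one_mul]
      exact hPmul ih h
  have hPmax : ∀ {n p}, 1 ≤ n → P n p → p.2.2 ≤ max p.1 p.2.1 := by
    intro n p hn h
    have hM : 0 ≤ max p.1 p.2.1 := le_max_of_le_left (hP0 h).1
    have h1 : ∀ ε : ℝ, 0 < ε → p.2.2 ≤ Real.exp (ε * n) * max p.1 p.2.1 := by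
      intro ε hε
      -- The bound is used for the `(N + 1)`-st tensor power of `z`, whose degree `(N + 1) * n` is
      -- at least `N`; the root of that order leaves `exp (ε n)`, and then `ε ↘ 0`.
      obtain ⟨N, hN⟩ := eventually_atTop.1 (hr ε hε)
      have h2 := hPr (Nat.mul_pos N.succ_pos hn) (hPpow h N)
      have h3 : max (p.1 ^ (N + 1)) (p.2.1 ^ (N + 1)) ≤ max p.1 p.2.1 ^ (N + 1) :=
        max_le (pow_le_pow_left₀ (hP0 h).1 (le_max_left _ _) _)
          (pow_le_pow_left₀ (hP0 h).2.1 (le_max_right _ _) _)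
      have h4 : p.2.2 ^ (N + 1) ≤ (Real.exp (ε * n) * max p.1 p.2.1) ^ (N + 1) := by
        rw [mul_pow, ← Real.exp_nat_mul]
        have hle : N ≤ (N + 1) * n := by nlinarith
        have h5 := hN _ hle
        have h6 : ε * (((N + 1) * n : ℕ) : ℝ) = ((N + 1 : ℕ) : ℝ) * (ε * n) := by
          push_cast; ring
        rw [h6] at h5
        exact h2.trans (mul_le_mul h5 h3 (le_max_of_le_left (pow_nonneg (hP0 h).1 _))
          (Real.exp_nonneg _))
      exact le_of_pow_le_pow_left₀ N.succ_ne_zero (mul_nonneg (Real.exp_nonneg _) hM) h4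
    have h2 : Tendsto (fun ε : ℝ => Real.exp (ε * n) * max p.1 p.2.1) (𝓝[>] 0)
        (𝓝 (max p.1 p.2.1)) := by
      have : ContinuousAt (fun ε : ℝ => Real.exp (ε * n) * max p.1 p.2.1) 0 := by fun_prop
      simpa [ContinuousAt] using this.tendsto.mono_left nhdsWithin_le_nhds
    refine ge_of_tendsto h2 ?_
    filter_upwards [self_mem_nhdsWithin] with ε hε using h1 ε hε
  obtain ⟨t, ht, hK⟩ := exists_mem_Icc_forall_le_rpow_mul_rpow
    (K := {p | ∃ n, 1 ≤ n ∧ P n p})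
    (by rintro p ⟨m, hm, hp⟩ q ⟨n, hn, hq⟩; exact ⟨m + n, by omega, hPmul hp hq⟩)
    (by rintro p ⟨m, hm, hp⟩; exact hP0 hp)
    (by rintro p ⟨m, hm, hp⟩; exact hPmax hm hp)
  refine ⟨t, ht, fun x => ?_⟩
  have hγ : ∀ i, 0 ≤ α i ^ t * β i ^ (1 - t) := fun i =>
    mul_nonneg (Real.rpow_nonneg (hα i) _) (Real.rpow_nonneg (hβ i) _)
  refine le_of_forall_pow_le_mul_pow (Finset.sum_nonneg fun _ _ => sq_nonneg _)
    (Finset.sum_nonneg fun i _ => mul_nonneg (hγ i) (sq_nonneg _)) (Fintype.card ι) fun n hn => ?_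
  -- The component of `x^{⊗n}` on the words of type `τ`. Words of one type have equal weights, so
  -- `hK` applies to it; there are at most `(n + 1) ^ card ι` types, which bounds the Cauchy-Schwarz
  -- loss in `tensorForm_sum_le`.
  let z : (ι → Fin (n + 1)) → (Fin n → ι) → ℂ := fun τ f =>
    if wordType f = τ then ∏ k, x (f k) else 0
  have hz : ∀ τ, tensorForm S n (z τ) ≤
      ∑ f, (∏ k, (α (f k) ^ t * β (f k) ^ (1 - t))) * ‖z τ f‖ ^ 2 := by
    intro τ
    by_cases h0 : ∀ f, z τ f = 0
    · simp [h0, tensorForm]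
    push Not at h0
    obtain ⟨g, hg⟩ := h0
    have hne : ∀ {f}, z τ f ≠ 0 → wordType f = τ := fun {f} hf => by
      by_contra h
      simp [z, h] at hf
    have hpos : 0 < ∑ f, ‖z τ f‖ ^ 2 :=
      Finset.sum_pos' (fun _ _ => sq_nonneg _) ⟨g, Finset.mem_univ g, by positivity⟩
    have h1 := hK (∏ k, α (g k), ∏ k, β (g k), tensorForm S n (z τ) / ∑ f, ‖z τ f‖ ^ 2)
      ⟨n, hn, z τ, fun f hf => ⟨prod_eq_of_wordType_eq ((hne hf).trans (hne hg).symm) α,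
        prod_eq_of_wordType_eq ((hne hf).trans (hne hg).symm) β⟩, hpos,
        (div_mul_cancel₀ _ hpos.ne').symm⟩
    simp only [div_le_iff₀ hpos] at h1
    refine h1.trans_eq ?_
    rw [Finset.mul_sum]
    refine Finset.sum_congr rfl fun f _ => ?_
    by_cases hf : z τ f = 0
    · simp [hf]
    · rw [Finset.prod_mul_distrib, Real.finsetProd_rpow _ _ (fun _ _ => hα _),
        Real.finsetProd_rpow _ _ (fun _ _ => hβ _),
        prod_eq_of_wordType_eq ((hne hf).trans (hne hg).symm) α,
        prod_eq_of_wordType_eq ((hne hf).trans (hne hg).symm) β]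
  have hsum : (fun f : Fin n → ι => ∏ k, x (f k)) = fun f => ∑ τ, z τ f := by
    ext f
    simp [z]
  rw [← tensorForm_prod, hsum]
  refine (tensorForm_sum_le S n z).trans ?_
  have hcard : (Fintype.card (ι → Fin (n + 1)) : ℝ) = ((n : ℝ) + 1) ^ Fintype.card ι := by
    simp
  rw [hcard]
  refine mul_le_mul_of_nonneg_left ((Finset.sum_le_sum fun τ _ => hz τ).trans_eq ?_)
    (by positivity)
  rw [Finset.sum_comm, ← sum_prod_eq_pow]
  refine Finset.sum_congr rfl fun f _ => ?_
  rw [Finset.sum_eq_single (wordType f)]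
  · simp only [z, if_true, norm_prod, Finset.prod_mul_distrib, Finset.prod_pow]
  · intro τ _ hτ
    simp [z, hτ.symm]
  · simp

end TensorForm

/-! ### Hölder's inequality with weights -/

theorem sum_rpow_mul_rpow_mul_le {σ : Type*} [Fintype σ] {a b x : σ → ℝ} (ha : ∀ i, 0 ≤ a i)
    (hb : ∀ i, 0 ≤ b i) (hx : ∀ i, 0 ≤ x i) {t : ℝ} (ht : t ∈ Set.Icc (0 : ℝ) 1) :
    ∑ i, a i ^ t * b i ^ (1 - t) * x i ≤
      (∑ i, a i * x i) ^ t * (∑ i, b i * x i) ^ (1 - t) := by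
  -- At the endpoints the conjugate exponents `t⁻¹` and `(1 - t)⁻¹` degenerate, but the claim is an
  -- equality.
  rcases ht.1.eq_or_lt with h0 | h0
  · simp [← h0]
  rcases ht.2.eq_or_lt with h1 | h1
  · simp [h1]
  have h1' : 0 < 1 - t := sub_pos.2 h1
  have hpq : (t⁻¹).HolderConjugate (1 - t)⁻¹ := by
    rw [Real.holderConjugate_iff]
    exact ⟨(one_lt_inv₀ h0).2 h1, by simp⟩
  have key := Real.inner_le_Lp_mul_Lq_of_nonneg Finset.univ hpq
    (f := fun i => (a i * x i) ^ t) (g := fun i => (b i * x i) ^ (1 - t))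
    (fun i _ => Real.rpow_nonneg (mul_nonneg (ha i) (hx i)) _)
    (fun i _ => Real.rpow_nonneg (mul_nonneg (hb i) (hx i)) _)
  simp only [one_div, inv_inv] at key
  have e1 : ∀ i, ((a i * x i) ^ t) ^ t⁻¹ = a i * x i := fun i =>
    Real.rpow_rpow_inv (mul_nonneg (ha i) (hx i)) h0.ne'
  have e2 : ∀ i, ((b i * x i) ^ (1 - t)) ^ (1 - t)⁻¹ = b i * x i := fun i =>
    Real.rpow_rpow_inv (mul_nonneg (hb i) (hx i)) h1'.ne'
  simp only [e1, e2] at key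
  refine le_trans (Finset.sum_le_sum fun i _ => le_of_eq ?_) key
  rw [Real.mul_rpow (ha i) (hx i), Real.mul_rpow (hb i) (hx i)]
  have : x i ^ t * x i ^ (1 - t) = x i := by
    rw [← Real.rpow_add_of_nonneg (hx i) h0.le h1'.le]
    simp
  calc _ = a i ^ t * b i ^ (1 - t) * (x i ^ t * x i ^ (1 - t)) := by rw [this]
    _ = _ := by ring

/-! ### The implications between the five conditions -/

section Main

variable {H : Type*} [NormedAddCommGroup H] [InnerProductSpace ℂ H] [FiniteDimensional ℂ H]
  [CompleteSpace H]

theorem powTr_le_of_le_diagOp {ι : Type*} [Fintype ι] (v : ι → H) {α β : ι → ℝ}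
    (hα : ∀ i, 0 ≤ α i) (hβ : ∀ i, 0 ≤ β i) {t : ℝ} (ht : t ∈ Set.Icc (0 : ℝ) 1)
    {C : H →L[ℂ] H} (hC : C.IsPositive) (h : C ≤ diagOp v fun i => α i ^ t * β i ^ (1 - t))
    (n : ℕ) {X : HilbertPower H n →ₗ[ℂ] HilbertPower H n} (hX : X.IsPositive) :
    powTr C n X ≤ powTr (diagOp v α) n X ^ t * powTr (diagOp v β) n X ^ (1 - t) := by
  classical
  refine (powTr_mono hC h n hX).trans ?_
  simp only [powTr_diagOp]
  refine le_of_eq_of_le ?_ (sum_rpow_mul_rpow_mul_le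
    (fun f => Finset.prod_nonneg fun _ _ => hα _) (fun f => Finset.prod_nonneg fun _ _ => hβ _)
    (fun f => hX.re_inner_nonneg_right _) ht)
  refine Finset.sum_congr rfl fun f _ => ?_
  rw [Finset.prod_mul_distrib, Real.finsetProd_rpow _ _ (fun _ _ => hα _),
    Real.finsetProd_rpow _ _ (fun _ _ => hβ _)]
  rfl

theorem opPower_le_of_le_diagOp {ι : Type*} [Fintype ι] (v : ι → H) {α β : ι → ℝ}
    (hα : ∀ i, 0 ≤ α i) (hβ : ∀ i, 0 ≤ β i) {t : ℝ} (ht : t ∈ Set.Icc (0 : ℝ) 1)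
    {C : H →L[ℂ] H} (hC : C.IsPositive) (h : C ≤ diagOp v fun i => α i ^ t * β i ^ (1 - t))
    (n : ℕ) :
    opPower C n ≤
      (t : ℂ) • opPower (diagOp v α) n + ((1 - t : ℝ) : ℂ) • opPower (diagOp v β) n := by
  classical
  refine (opPower_mono hC h n).trans ?_
  rw [opPower_diagOp', opPower_diagOp', opPower_diagOp', ← ContinuousLinearMap.toLinearMap_smul,
    ← ContinuousLinearMap.toLinearMap_smul, ← ContinuousLinearMap.toLinearMap_add,
    ContinuousLinearMap.coe_le_coe_iff, ← diagOp_smul, ← diagOp_smul, ← diagOp_add]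
  refine diagOp_mono _ fun f => ?_
  rw [Finset.prod_mul_distrib, Real.finsetProd_rpow _ _ (fun _ _ => hα _),
    Real.finsetProd_rpow _ _ (fun _ _ => hβ _)]
  exact Real.geom_mean_le_arith_mean2_weighted ht.1 (sub_nonneg.2 ht.2)
    (Finset.prod_nonneg fun _ _ => hα _) (Finset.prod_nonneg fun _ _ => hβ _) (by ring)

/-- The positive `X` are closed under addition, so the pairs of trace differences form a semigroup
to which the planar separation applies. Its conclusion at rank-one `X` is the operator inequality.
-/
theorem exists_opPower_le_of_powTr_le_max {A₁ A₂ C : H →L[ℂ] H} (hA₁ : A₁.IsPositive)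
    (hA₂ : A₂.IsPositive) (hC : C.IsPositive) {n : ℕ}
    (h : ∀ X : HilbertPower H n →ₗ[ℂ] HilbertPower H n, X.IsPositive →
      powTr C n X ≤ max (powTr A₁ n X) (powTr A₂ n X)) :
    ∃ t ∈ Set.Icc (0 : ℝ) 1, opPower C n ≤
      (t : ℂ) • opPower A₁ n + ((1 - t : ℝ) : ℂ) • opPower A₂ n := by
  obtain ⟨t, ht, hK⟩ := exists_mem_Icc_forall_le_mul
    (K := {a | ∃ X : HilbertPower H n →ₗ[ℂ] HilbertPower H n, X.IsPositive ∧
      a = (powTr A₁ n X - powTr A₂ n X, powTr C n X - powTr A₂ n X)}) (by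
    rintro _ ⟨X, hX, rfl⟩ _ ⟨Y, hY, rfl⟩
    refine ⟨X + Y, hX.add hY, ?_⟩
    simp only [powTr_add]
    ext <;> simp <;> ring) (by
    rintro _ ⟨X, hX, rfl⟩
    rcases le_max_iff.1 (h X hX) with h1 | h1
    · exact le_max_of_le_right (sub_le_sub_right h1 _)
    · exact le_max_of_le_left (sub_nonpos.2 h1))
  refine ⟨t, ht, ?_⟩
  have hs1 := ((opPower_isPositive hA₁ n).smul_of_nonneg
    (c := (t : ℂ)) (by exact_mod_cast ht.1)).add ((opPower_isPositive hA₂ n).smul_of_nonneg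
    (c := ((1 - t : ℝ) : ℂ)) (by exact_mod_cast sub_nonneg.2 ht.2))
  refine ⟨hs1.isSymmetric.sub (opPower_isPositive hC n).isSymmetric, fun z => ?_⟩
  have h1 := hK _ ⟨(rankOne ℂ z z).toLinearMap, (isPositive_rankOne_self z).toLinearMap, rfl⟩
  simp only [powTr_rankOne] at h1
  rw [← inner_conj_symm, RCLike.conj_re]
  simp only [LinearMap.sub_apply, LinearMap.add_apply, LinearMap.smul_apply, inner_sub_right,
    inner_add_right, inner_smul_right, RCLike.re_eq_complex_re, Complex.sub_re, Complex.add_re,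
    Complex.re_ofReal_mul]
  linarith

theorem eventually_le_exp_of_tendsto_log {r : ℕ → ℝ}
    (h : Tendsto (fun n : ℕ => ((1 / (n : ℝ) : ℝ) : EReal) *
      ENNReal.log (ENNReal.ofReal (r n))) atTop (𝓝 0)) {ε : ℝ} (hε : 0 < ε) :
    ∀ᶠ n : ℕ in atTop, r n ≤ Real.exp (ε * n) := by
  have h1 := h.eventually (gt_mem_nhds (a := ((ε : ℝ) : EReal)) (EReal.coe_pos.2 hε))
  filter_upwards [h1, eventually_ge_atTop 1] with n hn hn1
  -- Here the logarithm is `-∞` and carries no information, but the bound is trivial.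
  rcases le_or_gt (r n) 0 with h0 | h0
  · exact h0.trans (Real.exp_nonneg _)
  · have hn0 : (0 : ℝ) < n := by exact_mod_cast hn1
    rw [ENNReal.log_ofReal_of_pos h0, ← EReal.coe_mul, EReal.coe_lt_coe_iff, one_div,
      inv_mul_lt_iff₀ hn0] at hn
    rw [← Real.log_le_iff_le_exp h0]
    linarith

-- Write `C = ∑ |u_k⟩⟨u_k|` and expand vectors in the basis dual to `v`. The powers of the diagonal
-- operators become weighted sums of `‖z f‖ ^ 2` and `C^{⊗n}` becomes `tensorForm` of the matrix
-- `⟨u_k, w_i⟩`; moreover `p a + q b ≤ (p + q) max(a, b)`.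
omit [CompleteSpace H] in
theorem exists_le_diagOp_of_opPower_le {ι : Type*} [Fintype ι] (v : Module.Basis ι ℂ H)
    {α β : ι → ℝ} (hα : ∀ i, 0 ≤ α i) (hβ : ∀ i, 0 ≤ β i) {C : H →L[ℂ] H} (hC : C.IsPositive)
    {p q : ℕ → ℝ} (hpq : ∀ n : ℕ, 1 ≤ n → 0 ≤ p n ∧ 0 ≤ q n ∧ opPower C n ≤
      (p n : ℂ) • opPower (diagOp v α) n + (q n : ℂ) • opPower (diagOp v β) n)
    (hr : ∀ ε : ℝ, 0 < ε → ∀ᶠ n : ℕ in atTop, p n + q n ≤ Real.exp (ε * n)) :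
    ∃ t ∈ Set.Icc (0 : ℝ) 1, C ≤ diagOp v fun i => α i ^ t * β i ^ (1 - t) := by
  classical
  obtain ⟨m, u, rfl⟩ := exists_eq_diagOp_one hC
  obtain ⟨w, -, hw1, hw0, hw⟩ := exists_inner_dual v
  have hvw : ∀ i j, inner ℂ (v i) (w j) = if i = j then 1 else 0 := fun i j => by
    split_ifs with hij
    · rw [hij, hw1]
    · exact hw0 _ _ hij
  obtain ⟨t, ht, hx⟩ := exists_tensorForm_le_rpow (fun k i => inner ℂ (u k) (w i)) hα hβ hr (by
    intro n hn z
    obtain ⟨hp, hq, hle⟩ := hpq n hn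
    let Z : HilbertPower H n := ∑ f : Fin n → ι, z f • pureTensor fun k => w (f k)
    have hZu : ∀ h : Fin n → Fin m, inner ℂ (pureTensor fun k => u (h k)) Z =
        ∑ f : Fin n → ι, (∏ k, inner ℂ (u (h k)) (w (f k))) * z f := fun h => by
      simp only [Z, inner_sum, inner_smul_right, inner_pureTensor, mul_comm]
    have hZv : ∀ g : Fin n → ι, inner ℂ (pureTensor fun k => v (g k)) Z = z g := fun g => by
      simp only [Z, inner_sum, inner_smul_right, inner_pureTensor, hvw]
      rw [Finset.sum_eq_single g]
      · simp
      · intro f _ hf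
        obtain ⟨k, hk⟩ := Function.ne_iff.1 hf
        rw [Finset.prod_eq_zero (Finset.mem_univ k) (if_neg hk.symm), mul_zero]
      · simp
    have h1 := hle.re_inner_nonneg_right Z
    simp only [LinearMap.sub_apply, LinearMap.add_apply, LinearMap.smul_apply, inner_sub_right,
      inner_add_right, inner_smul_right, RCLike.re_eq_complex_re, Complex.sub_re, Complex.add_re,
      Complex.re_ofReal_mul, opPower_diagOp, inner_diagOp_self, Complex.ofReal_re, hZu, hZv,
      Finset.prod_const_one, one_mul] at h1
    refine (sub_nonneg.1 h1).trans ?_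
    rw [Finset.mul_sum, Finset.mul_sum, ← Finset.sum_add_distrib]
    refine Finset.sum_le_sum fun f _ => ?_
    rw [← mul_assoc, ← mul_assoc, ← add_mul, add_mul (p n)]
    gcongr
    · exact le_max_left _ _
    · exact le_max_right _ _)
  refine ⟨t, ht, ?_⟩
  have hG := diagOp_isPositive v (α := fun i => α i ^ t * β i ^ (1 - t)) fun i =>
    mul_nonneg (Real.rpow_nonneg (hα i) _) (Real.rpow_nonneg (hβ i) _)
  refine ⟨hG.isSymmetric.sub hC.isSymmetric, fun x => ?_⟩
  have h1 := hx fun i => inner ℂ (v i) x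
  have h2 : ∀ k, ∑ i, inner ℂ (u k) (w i) * inner ℂ (v i) x = inner ℂ (u k) x := fun k => by
    conv_rhs => rw [hw x]
    simp only [inner_sum, inner_smul_right, mul_comm]
  simp only [h2] at h1
  rw [ContinuousLinearMap.reApplyInnerSelf, ← inner_conj_symm, RCLike.conj_re, _root_.sub_apply,
    inner_sub_right, inner_diagOp_self, inner_diagOp_self, ← Complex.ofReal_sub,
    RCLike.re_eq_complex_re, Complex.ofReal_re]
  simpa only [one_mul, sub_nonneg] using h1

end Main

theorem mainTheorem5 {H : Type*} [NormedAddCommGroup H] [InnerProductSpace ℂ H]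
    [FiniteDimensional ℂ H] [CompleteSpace H] (A₁ A₂ C : H →L[ℂ] H)
    (hA₁ : A₁.IsPositive) (hA₂ : A₂.IsPositive) (hC : C.IsPositive) :
    List.TFAE [
      ∀ n : ℕ, 1 ≤ n → ∀ X : HilbertPower H n →ₗ[ℂ] HilbertPower H n,
        X.IsPositive →
          powTr C n X ≤
            max (powTr A₁ n X) (powTr A₂ n X),
      ∃ p ∈ Set.Icc (0 : ℝ) 1, ∀ n : ℕ, 1 ≤ n →
        opPower C n ≤
          (p : ℂ) • opPower A₁ n + ((1 - p : ℝ) : ℂ) • opPower A₂ n,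
      ∃ p q : ℕ → ℝ,
        (∀ n : ℕ, 1 ≤ n → 0 ≤ p n ∧ 0 ≤ q n ∧
          opPower C n ≤
            (p n : ℂ) • opPower A₁ n + (q n : ℂ) • opPower A₂ n) ∧
        Tendsto (fun n : ℕ => ((1 / (n : ℝ) : ℝ) : EReal) *
          ENNReal.log (ENNReal.ofReal (p n + q n))) atTop (𝓝 0),
      ∃ t ∈ Set.Icc (0 : ℝ) 1, ∀ n : ℕ, 1 ≤ n →
        ∀ X : HilbertPower H n →ₗ[ℂ] HilbertPower H n,
          X.IsPositive →
            powTr C n X ≤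
              powTr A₁ n X ^ t * powTr A₂ n X ^ (1 - t),
      ∃ t ∈ Set.Icc (0 : ℝ) 1, ∃ G : H →L[ℂ] H,
        IsKuboAndoMean t A₂ A₁ G ∧ C ≤ G] := by
  -- Limits are unique, so any `G` given by (v) is the explicit diagonal mean.
  have h54 : ∀ {t : ℝ} {G : H →L[ℂ] H}, t ∈ Set.Icc (0 : ℝ) 1 → IsKuboAndoMean t A₂ A₁ G →
      ∃ (v : Module.Basis (Fin (Module.finrank ℂ H)) ℂ H)
        (α β : Fin (Module.finrank ℂ H) → ℝ), (∀ i, 0 ≤ α i) ∧ (∀ i, 0 ≤ β i) ∧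
        A₁ = diagOp v α ∧ A₂ = diagOp v β ∧ G = diagOp v fun i => α i ^ t * β i ^ (1 - t) := by
    intro t G ht hG
    obtain ⟨v, α, β, hα, hβ, rfl, rfl⟩ := exists_simultaneous_diagOp hA₁ hA₂
    exact ⟨v, α, β, hα, hβ, rfl, rfl, tendsto_nhds_unique hG (isKuboAndoMean_diagOp v hα hβ ht)⟩
  have log_one : Tendsto (fun n : ℕ => ((1 / (n : ℝ) : ℝ) : EReal) *
      ENNReal.log (ENNReal.ofReal 1)) atTop (𝓝 0) := by
    simp
  tfae_have 5 → 4 := by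
    rintro ⟨t, ht, G, hG, hCG⟩
    obtain ⟨v, α, β, hα, hβ, rfl, rfl, rfl⟩ := h54 ht hG
    exact ⟨t, ht, fun n _ X hX => powTr_le_of_le_diagOp v hα hβ ht hC hCG n hX⟩
  tfae_have 5 → 2 := by
    rintro ⟨t, ht, G, hG, hCG⟩
    obtain ⟨v, α, β, hα, hβ, rfl, rfl, rfl⟩ := h54 ht hG
    exact ⟨t, ht, fun n _ => opPower_le_of_le_diagOp v hα hβ ht hC hCG n⟩
  tfae_have 4 → 1 := by
    rintro ⟨t, ht, h⟩ n hn X hX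
    have h1 := powTr_nonneg hA₁ n hX
    have h2 := powTr_nonneg hA₂ n hX
    have h3 : 0 ≤ max (powTr A₁ n X) (powTr A₂ n X) := le_max_of_le_left h1
    have ht' : 0 ≤ 1 - t := sub_nonneg.2 ht.2
    calc powTr C n X ≤ _ := h n hn X hX
      _ ≤ max (powTr A₁ n X) (powTr A₂ n X) ^ t *
          max (powTr A₁ n X) (powTr A₂ n X) ^ (1 - t) := by
        exact mul_le_mul (Real.rpow_le_rpow h1 (le_max_left _ _) ht.1)
          (Real.rpow_le_rpow h2 (le_max_right _ _) ht') (Real.rpow_nonneg h2 _)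
          (Real.rpow_nonneg h3 _)
      _ = _ := by
        rw [← Real.rpow_add_of_nonneg h3 ht.1 ht', add_sub_cancel, Real.rpow_one]
  tfae_have 2 → 3 := by
    rintro ⟨p, hp, h⟩
    refine ⟨fun _ => p, fun _ => 1 - p, fun n hn => ⟨hp.1, sub_nonneg.2 hp.2, h n hn⟩, ?_⟩
    simpa only [add_sub_cancel] using log_one
  tfae_have 1 → 3 := by
    intro h
    have : ∀ n : ℕ, ∃ t ∈ Set.Icc (0 : ℝ) 1, 1 ≤ n → opPower C n ≤
        (t : ℂ) • opPower A₁ n + ((1 - t : ℝ) : ℂ) • opPower A₂ n := by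
      intro n
      by_cases hn : 1 ≤ n
      · obtain ⟨t, ht, h1⟩ := exists_opPower_le_of_powTr_le_max hA₁ hA₂ hC (h n hn)
        exact ⟨t, ht, fun _ => h1⟩
      · exact ⟨0, ⟨le_rfl, zero_le_one⟩, fun h1 => (hn h1).elim⟩
    choose p hp h1 using this
    refine ⟨p, fun n => 1 - p n,
      fun n hn => ⟨(hp n).1, sub_nonneg.2 (hp n).2, h1 n hn⟩, ?_⟩
    simpa only [add_sub_cancel] using log_one
  tfae_have 3 → 5 := by
    rintro ⟨p, q, hpq, hlim⟩
    obtain ⟨v, α, β, hα, hβ, rfl, rfl⟩ := exists_simultaneous_diagOp hA₁ hA₂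
    obtain ⟨t, ht, h⟩ := exists_le_diagOp_of_opPower_le v hα hβ hC hpq
      fun ε hε => eventually_le_exp_of_tendsto_log hlim hε
    exact ⟨t, ht, _, isKuboAndoMean_diagOp v hα hβ ht, h⟩
  tfae_finish
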